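/- Let $X$ be a complex Banach space, $0<\delta<\pi/2$, and $\Sigma_\delta=\{z\in\mathbb C:\ |\arg(-z)|\le\delta\}$, where the vertex $0$ is included in $\Sigma_\delta$. Let $u:(0,\infty)\to X$ be locally integrable with exponential growth, in the sense that $t\mapsto e^{-\omega t}u(t)$ is integrable on $(0,\infty)$ for some $\omega\in\mathbb R$. Suppose that its Laplace transform $\int_0^\infty e^{-zt}u(t)\,dt$ has a holomorphic extension $U:\mathbb C\setminus\Sigma_\delta\to X$, and that for some $M>0$, $$\|U(z)\|\le \frac{M}{|z|},\qquad z\notin\Sigma_\delta .$$ Then $u$ coincides almost everywhere on $(0,\infty)$, and at every point of continuity of $u$, with a continuous function on $(0,\infty)$. We denote this function again by $u$. The following holds for it. Let $\alpha,d$ satisfy $0<\alpha-d<\alpha+d<\frac{\pi}{2}-\delta$. For $\lambda,h>0$ and an integer $n\ge1$ put $$T(w)=1-\sin(\alpha+iw),\qquad G_t(w)=-\frac{\lambda}{2\pi i}\,e^{\lambda tT(w)}\,U(\lambda T(w))\,T'(w),\qquad u_n(t)=h\sum_{k=-n}^{n}G_t(kh).$$ Let $t_0>0$, $\Lambda\ge1$,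 $0<\theta<1$, let $n\ge1$ be an integer, and choose $$a(\theta)=\operatorname{arccosh}\Big(\frac{\Lambda}{(1-\theta)\sin\alpha}\Big),\qquad h=\frac{a(\theta)}{n},\qquad \lambda=\frac{2\pi d\,n\,(1-\theta)}{t_0\,\Lambda\,a(\theta)} .$$ Then for every $t\in[t_0,\Lambda t_0]$, $$\|u(t)-u_n(t)\|\le M\,\varphi(\alpha,d)\,L\big(\lambda t_0\sin(\alpha-d)\big)\,\frac{2\,\epsilon_n(\theta)^{\theta}}{1-\epsilon_n(\theta)},$$ where $$\epsilon_n(\theta)=\exp\Big(-\frac{2\pi d}{a(\theta)}\,n\Big),\qquad \varphi(\alpha,d)=\frac{2}{\pi}\sqrt{\frac{1+\sin(\alpha+d)}{1-\sin(\alpha+d)}},\qquad L(x)=1+|\ln(1-e^{-x})|\quad(x>0).$$ -/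

import Mathlib

open MeasureTheory Set

noncomputable section

/-- The closed sector `{z : |arg (-z)| ≤ δ}` around the negative real axis; its vertex `0`
belongs to it, because `Complex.arg 0 = 0`. -/
def sector (δ : ℝ) : Set ℂ := {z : ℂ | |Complex.arg (-z)| ≤ δ}

/-- `U` is holomorphic off the sector `sector δ` and there it extends the Laplace transform
`∫₀^∞ e^{-zt} u(t) dt` of `u : (0, ∞) → X` (the values of `u` on `(-∞, 0]` play no role).
Local integrability and exponential growth of `u` enter in the weakest usual form: the Laplace
integral converges absolutely on some right half plane. -/
def IsLaplaceTransformOffSector {X : Type*} [NormedAddCommGroup X] [NormedSpace ℂ X]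
    (u : ℝ → X) (U : ℂ → X) (δ : ℝ) : Prop :=
  DifferentiableOn ℂ U (sector δ)ᶜ ∧
    ∃ ω : ℝ, IntegrableOn (fun t : ℝ => Real.exp (-(ω * t)) • u t) (Ioi 0) ∧
      ∀ z : ℂ, z ∉ sector δ → ω < z.re →
        U z = ∫ t in Ioi (0 : ℝ), Complex.exp (-(z * (t : ℂ))) • u t

/-- The map `T(w) = 1 - sin (α + i w)`, which parametrizes a branch of a hyperbola for real `w`. -/
def hyperbolaMap (α : ℝ) (w : ℂ) : ℂ := 1 - Complex.sin ((α : ℂ) + Complex.I * w)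

/-- The integrand `G_t(w) = -(λ / 2πi) exp (λ t T(w)) U(λ T(w)) T'(w)`. -/
def inversionIntegrand {X : Type*} [NormedAddCommGroup X] [NormedSpace ℂ X]
    (U : ℂ → X) (α lam t : ℝ) (w : ℂ) : X :=
  (-((lam : ℂ) / (2 * (Real.pi : ℂ) * Complex.I)) *
      Complex.exp ((lam : ℂ) * (t : ℂ) * hyperbolaMap α w) * deriv (hyperbolaMap α) w) •
    U ((lam : ℂ) * hyperbolaMap α w)

/-- The truncated trapezoidal rule `u_n(t) = h ∑_{k=-n}^{n} G_t(k h)`. -/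
def trapezoidalApprox {X : Type*} [NormedAddCommGroup X] [NormedSpace ℂ X]
    (U : ℂ → X) (α lam h : ℝ) (n : ℕ) (t : ℝ) : X :=
  (h : ℂ) • ∑ k ∈ Finset.Icc (-(n : ℤ)) (n : ℤ),
    inversionIntegrand U α lam t ((k : ℂ) * (h : ℂ))

/-- `φ(α, d) = (2/π) √((1 + sin (α + d)) / (1 - sin (α + d)))`. -/
def phiConst (α d : ℝ) : ℝ :=
  2 / Real.pi * Real.sqrt ((1 + Real.sin (α + d)) / (1 - Real.sin (α + d)))

/-- `L(x) = 1 + |ln (1 - e^{-x})|`. -/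
def logFactor (x : ℝ) : ℝ := 1 + |Real.log (1 - Real.exp (-x))|

end

/-! The representative of `u` is the contour integral `v(t) = ∫ G_t(x) dx` along the hyperbola.

Identification of `v` with `u`: pair `v` with a test function `g` supported in `(0, ∞)`. After
Fubini, the exponential becomes `ĝ(ζ) = ∫ g(t) e^{ζt} dt`, which is `O(1/|ζ|)` on every left half
plane. Hence `ĝ U` decays quadratically, and the hyperbola can be deformed to `Re z = λ` and on to
the half plane where `U` is the Laplace integral. Parseval's identity there returns `2π ∫ g u`
(`hyperbolicInverse_ae_eq`). In particular `v` does not depend on `α` or `λ`.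

Discretization: `G_t` is holomorphic in `|Im w| ≤ d`. By Poisson summation the error of the infinite
trapezoidal rule is a sum of Fourier coefficients at `k / h`, `k ≠ 0`, and shifting the line by `±d`
produces the geometric series `ε / (1 - ε)`. On the shifted lines `|G_t|` is at most a constant
times `e^{λt} e^{-γ cosh x}` with `γ = λ t₀ sin (α - d)`, whose integral is controlled by `L(γ)`.

Truncation: the terms dropped decay like `exp (-λ t sin α cosh x)`. Factoring out the value at `x =
a` leaves a sum again controlled by `L(γ)`.

The parameters balance the errors: with `ε = e^{-q}`, the choice of `λ` gives `λ Λ t₀ = q (1 - θ)`,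
and that of `a` makes the truncation factor at most `ε^θ` as well. -/

open Filter Topology in
theorem tendsto_const_div_one_add_sq (C : ℝ) :
    Tendsto (fun R : ℝ => C / (1 + R ^ 2)) atTop (𝓝 0) :=
  Tendsto.div_atTop tendsto_const_nhds
    (tendsto_atTop_add_const_left _ _ (tendsto_pow_atTop two_ne_zero))

theorem integrable_const_div_one_add_sq (C : ℝ) :
    Integrable fun x : ℝ => C / (1 + x ^ 2) := by
  simpa [div_eq_mul_inv] using integrable_inv_one_add_sq.const_mul C

/-! ### Shifting the line of integration in a strip -/

section HorizontalLines

variable {E : Type*} [NormedAddCommGroup E] [NormedSpace ℂ E] {F : ℂ → E} {a b C : ℝ}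

theorem continuous_horizontal {y : ℝ} (hF : ∀ w : ℂ, w.im = y → DifferentiableAt ℂ F w) :
    Continuous fun x : ℝ => F (x + y * Complex.I) := by
  refine continuous_iff_continuousAt.2 fun x => ?_
  have h : ContinuousAt F (x + y * Complex.I) := (hF _ (by simp)).continuousAt
  exact ContinuousAt.comp (f := fun x : ℝ => (x + y * Complex.I : ℂ)) h (by fun_prop)

theorem integrable_horizontal {y : ℝ} (hF : ∀ w : ℂ, w.im = y → DifferentiableAt ℂ F w)
    (hB : ∀ w : ℂ, w.im = y → ‖F w‖ ≤ C / (1 + w.re ^ 2)) :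
    Integrable fun x : ℝ => F (x + y * Complex.I) := by
  refine (integrable_const_div_one_add_sq C).mono'
    (continuous_horizontal hF).aestronglyMeasurable (.of_forall fun x => ?_)
  simpa using hB (x + y * Complex.I) (by simp)

open Filter Topology in
/-- Cauchy's theorem in a strip, for functions with quadratic decay. -/
theorem integral_horizontal_eq [CompleteSpace E] (hab : a ≤ b)
    (hF : ∀ w : ℂ, w.im ∈ Icc a b → DifferentiableAt ℂ F w)
    (hB : ∀ w : ℂ, w.im ∈ Icc a b → ‖F w‖ ≤ C / (1 + w.re ^ 2)) :
    ∫ x : ℝ, F (x + a * Complex.I) = ∫ x : ℝ, F (x + b * Complex.I) := by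
  have hlim : ∀ y ∈ Icc a b, Tendsto (fun R : ℝ => ∫ x in (-R)..R, F (x + y * Complex.I)) atTop
      (𝓝 (∫ x : ℝ, F (x + y * Complex.I))) := fun y hy =>
    intervalIntegral_tendsto_integral
      (integrable_horizontal (fun w hw => hF w (hw ▸ hy)) (fun w hw => hB w (hw ▸ hy)))
      tendsto_neg_atTop_atBot tendsto_id
  have hside : ∀ s : ℝ, s ^ 2 = 1 →
      Tendsto (fun R : ℝ => Complex.I • ∫ y in a..b, F ((s * R : ℝ) + y * Complex.I)) atTop
        (𝓝 0) := by
    intro s hs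
    refine squeeze_zero_norm (a := fun R => C / (1 + R ^ 2) * |b - a|) (fun R => ?_) ?_
    · rw [norm_smul, Complex.norm_I, one_mul]
      refine intervalIntegral.norm_integral_le_of_norm_le_const fun y hy => ?_
      rw [uIoc_of_le hab] at hy
      have := hB ((s * R : ℝ) + y * Complex.I) (by simpa using Ioc_subset_Icc_self hy)
      simpa [mul_pow, hs] using this
    · simpa using (tendsto_const_div_one_add_sq C).mul_const |b - a|
  have hrect : ∀ R : ℝ, (∫ x in (-R)..R, F (x + a * Complex.I)) -
      (∫ x in (-R)..R, F (x + b * Complex.I)) +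
      Complex.I • (∫ y in a..b, F ((1 * R : ℝ) + y * Complex.I)) -
      Complex.I • (∫ y in a..b, F ((-1 * R : ℝ) + y * Complex.I)) = 0 := by
    intro R
    have := Complex.integral_boundary_rect_eq_zero_of_differentiableOn F
      (-R + a * Complex.I) (R + b * Complex.I) (fun w hw => by
        refine (hF w ?_).differentiableWithinAt
        have := hw.2
        simpa [uIcc_of_le hab] using this)
    simpa using this
  have h := (((hlim a ⟨le_rfl, hab⟩).sub (hlim b ⟨hab, le_rfl⟩)).add
    (hside 1 (by norm_num))).sub (hside (-1) (by norm_num))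
  simp only [hrect, add_zero, sub_zero] at h
  exact (sub_eq_zero.1 (tendsto_nhds_unique tendsto_const_nhds h).symm)

end HorizontalLines

/-! ### The infinite trapezoidal rule in a strip -/

section Trapezoidal

open FourierTransform

theorem summable_of_norm_le_div_one_add_sq {E : Type*} [NormedAddCommGroup E] [CompleteSpace E]
    {f : ℤ → E} {C h : ℝ} (hh : 0 < h) (hf : ∀ k : ℤ, ‖f k‖ ≤ C / (1 + (h * k) ^ 2)) :
    Summable f := by
  have hC : 0 ≤ C := by simpa using (norm_nonneg _).trans (hf 0)
  have hs : Summable fun k : ℤ => C / h ^ 2 * (1 / (k : ℝ) ^ 2) :=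
    (Real.summable_one_div_int_pow.2 one_lt_two).mul_left _
  refine Summable.of_norm_bounded_eventually hs ?_
  filter_upwards [(Set.finite_singleton (0 : ℤ)).compl_mem_cofinite] with k hk
  have hk' : (k : ℝ) ≠ 0 := by simpa using hk
  refine (hf k).trans ?_
  rw [div_mul_div_comm, mul_one, mul_pow]
  gcongr
  linarith

/-- Fourier transform estimate after moving the line of integration by `y`. -/
theorem norm_fourier_le_of_strip {F : ℂ → ℂ} {y C : ℝ}
    (hF : ∀ w : ℂ, w.im ∈ uIcc 0 y → DifferentiableAt ℂ F w)
    (hB : ∀ w : ℂ, w.im ∈ uIcc 0 y → ‖F w‖ ≤ C / (1 + w.re ^ 2)) (ξ : ℝ) :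
    ‖𝓕 (fun x : ℝ => F x) ξ‖ ≤
      Real.exp (2 * Real.pi * y * ξ) * ∫ x : ℝ, ‖F (x + y * Complex.I)‖ := by
  -- The entire extension of the Fourier character; on the line `Im w = y` its modulus is the
  -- constant `e^{2πyξ}`, which is the gain.
  set e : ℂ → ℂ := fun w => Complex.exp (-(2 * Real.pi * ξ * Complex.I * w)) with he
  have hnorm : ∀ w, ‖e w‖ = Real.exp (2 * Real.pi * ξ * w.im) := by
    intro w
    simp [he, Complex.norm_exp]
  have hbound : ∀ w : ℂ, w.im ∈ uIcc 0 y →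
      ‖e w * F w‖ ≤ (Real.exp (2 * Real.pi * |ξ| * |y|) * C) / (1 + w.re ^ 2) := by
    intro w hw
    rw [norm_mul, hnorm, mul_div_assoc]
    have hy : |w.im| ≤ |y| := by
      have := abs_sub_left_of_mem_uIcc hw
      simpa using this
    have hexp : 2 * Real.pi * ξ * w.im ≤ 2 * Real.pi * |ξ| * |y| :=
      calc 2 * Real.pi * ξ * w.im ≤ |2 * Real.pi * ξ * w.im| := le_abs_self _
        _ = 2 * Real.pi * |ξ| * |w.im| := by
          rw [abs_mul, abs_mul, abs_of_pos Real.two_pi_pos]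
        _ ≤ _ := by gcongr
    exact mul_le_mul (Real.exp_le_exp.2 hexp) (hB w hw) (norm_nonneg _) (Real.exp_pos _).le
  have hdiff : ∀ w : ℂ, w.im ∈ uIcc 0 y → DifferentiableAt ℂ (fun w => e w * F w) w :=
    fun w hw => by
      have h1 : DifferentiableAt ℂ e w := by simp only [he]; fun_prop
      exact h1.mul (hF w hw)
  have hshift : ∫ x : ℝ, e x * F x = ∫ x : ℝ, e (x + y * Complex.I) * F (x + y * Complex.I) := by
    rcases le_total 0 y with h0 | h0
    · rw [uIcc_of_le h0] at hdiff hbound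
      simpa using integral_horizontal_eq h0 hdiff hbound
    · rw [uIcc_of_ge h0] at hdiff hbound
      simpa using (integral_horizontal_eq h0 hdiff hbound).symm
  have hfour : 𝓕 (fun x : ℝ => F x) ξ = ∫ x : ℝ, e x * F x := by
    rw [Real.fourier_real_eq_integral_exp_smul]
    congr 1
    ext x
    simp only [smul_eq_mul, he]
    congr 2
    push_cast
    ring
  rw [hfour, hshift, ← integral_const_mul]
  refine (norm_integral_le_integral_norm _).trans_eq ?_
  congr 1
  ext x
  rw [norm_mul, hnorm]
  congr 2
  simp
  ring

/-- Error of the bi-infinite trapezoidal rule for functions holomorphic in a strip. -/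
theorem norm_integral_sub_tsum_le_of_strip_complex {F : ℂ → ℂ} {d h C : ℝ} (hd : 0 < d)
    (hh : 0 < h) (hF : ∀ w : ℂ, |w.im| ≤ d → DifferentiableAt ℂ F w)
    (hB : ∀ w : ℂ, |w.im| ≤ d → ‖F w‖ ≤ C / (1 + w.re ^ 2)) :
    ‖(∫ x : ℝ, F x) - h * ∑' k : ℤ, F (k * h)‖ ≤
      Real.exp (-(2 * Real.pi * d / h)) / (1 - Real.exp (-(2 * Real.pi * d / h))) *
        ((∫ x : ℝ, ‖F (x + d * Complex.I)‖) + ∫ x : ℝ, ‖F (x + (-d : ℝ) * Complex.I)‖) := by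
  set ε := Real.exp (-(2 * Real.pi * d / h)) with hε
  have hε0 : 0 < ε := Real.exp_pos _
  have hε1 : ε < 1 := by
    rw [hε, Real.exp_lt_one_iff]
    have : 0 < 2 * Real.pi * d / h := by positivity
    linarith
  set A := ∫ x : ℝ, ‖F (x + d * Complex.I)‖
  set B := ∫ x : ℝ, ‖F (x + (-d : ℝ) * Complex.I)‖
  -- Rescaling by `h` moves the nodes `k h` to the integers, as Poisson summation requires.
  set f : ℝ → ℂ := fun x => F (h * x : ℝ) with hf
  set g : ℝ → ℂ := fun x => F x with hg
  -- The upward shift gives decay at negative frequencies, the downward shift at positive ones.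
  have hup : ∀ ξ, ‖𝓕 g ξ‖ ≤ Real.exp (2 * Real.pi * d * ξ) * A := fun ξ =>
    norm_fourier_le_of_strip (C := C)
      (fun w hw => hF w (by rw [uIcc_of_le hd.le] at hw; exact abs_le.2 ⟨by linarith [hw.1], hw.2⟩))
      (fun w hw => hB w (by rw [uIcc_of_le hd.le] at hw; exact abs_le.2 ⟨by linarith [hw.1], hw.2⟩))
      ξ
  have hdown : ∀ ξ, ‖𝓕 g ξ‖ ≤ Real.exp (2 * Real.pi * (-d) * ξ) * B := fun ξ =>
    norm_fourier_le_of_strip (C := C)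
      (fun w hw => hF w (by
        rw [uIcc_of_ge (by linarith)] at hw; exact abs_le.2 ⟨hw.1, by linarith [hw.2]⟩))
      (fun w hw => hB w (by
        rw [uIcc_of_ge (by linarith)] at hw; exact abs_le.2 ⟨hw.1, by linarith [hw.2]⟩))
      ξ
  have hfour : ∀ ξ : ℝ, h * 𝓕 f ξ = 𝓕 g (ξ / h) := by
    intro ξ
    rw [Real.fourier_real_eq_integral_exp_smul, Real.fourier_real_eq_integral_exp_smul]
    have := Measure.integral_comp_mul_left
      (fun y : ℝ => Complex.exp ((-2 * Real.pi * y * (ξ / h) : ℝ) * Complex.I) • g y) h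
    have h2 : ∀ x : ℝ, -2 * Real.pi * (h * x) * (ξ / h) = -2 * Real.pi * x * ξ := by
      intro x; field_simp
    simp only [h2] at this
    rw [show (∫ v : ℝ, Complex.exp ((-2 * Real.pi * v * ξ : ℝ) * Complex.I) • f v) = _ from this,
      abs_of_pos (by positivity), Complex.real_smul]
    push_cast
    rw [← mul_assoc, mul_inv_cancel₀ (by exact_mod_cast hh.ne'), one_mul]
  have hcont : Continuous f := by
    have : Continuous g := by
      simpa using continuous_horizontal (F := F) (y := 0) (fun w hw => hF w (by simp [hw, hd.le]))
    exact this.comp (by fun_prop)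
  have hposε : ∀ m : ℕ, Real.exp (2 * Real.pi * d * (-(m + 1 : ℝ) / h)) = ε ^ (m + 1) := by
    intro m
    rw [hε, ← Real.exp_nat_mul]
    congr 1
    push_cast
    ring
  have hA : ∀ m : ℕ, ‖𝓕 g ((-((m : ℤ) + 1 : ℤ) : ℝ) / h)‖ ≤ ε ^ (m + 1) * A := by
    intro m
    refine (hup _).trans_eq ?_
    rw [← hposε]
    push_cast
    ring_nf
  have hBb : ∀ m : ℕ, ‖𝓕 g ((((m : ℤ) + 1 : ℤ) : ℝ) / h)‖ ≤ ε ^ (m + 1) * B := by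
    intro m
    refine (hdown _).trans_eq ?_
    rw [← hposε]
    push_cast
    ring_nf
  have hgeo : ∀ D : ℝ, HasSum (fun m : ℕ => ε ^ (m + 1) * D) (ε / (1 - ε) * D) := by
    intro D
    have := ((hasSum_geometric_of_lt_one hε0.le hε1).mul_left ε).mul_right D
    simpa [pow_succ', div_eq_mul_inv] using this
  have hsumA : Summable fun m : ℕ => 𝓕 g ((-((m : ℤ) + 1 : ℤ) : ℝ) / h) :=
    Summable.of_norm_bounded (hgeo A).summable hA
  have hsumB : Summable fun m : ℕ => 𝓕 g ((((m : ℤ) + 1 : ℤ) : ℝ) / h) :=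
    Summable.of_norm_bounded (hgeo B).summable hBb
  have hsum : HasSum (fun k : ℤ => 𝓕 g ((k : ℝ) / h))
      ((∑' m : ℕ, 𝓕 g ((((m : ℤ) + 1 : ℤ) : ℝ) / h)) + 𝓕 g 0 +
        ∑' m : ℕ, 𝓕 g ((-((m : ℤ) + 1 : ℤ) : ℝ) / h)) := by
    have := HasSum.of_add_one_of_neg_add_one (f := fun k : ℤ => 𝓕 g ((k : ℝ) / h))
      (by simpa using hsumB.hasSum) (by simpa using hsumA.hasSum)
    simpa using this
  have hsumf : Summable fun k : ℤ => 𝓕 f k := by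
    have := hsum.summable.mul_left (h : ℂ)⁻¹
    refine this.congr fun k => ?_
    rw [← hfour, ← mul_assoc, inv_mul_cancel₀ (by exact_mod_cast hh.ne'), one_mul]
  have hdecay : f =O[Filter.cocompact ℝ] fun x : ℝ => |x| ^ (-2 : ℝ) := by
    refine Asymptotics.IsBigO.of_bound (C / h ^ 2) ?_
    have : ∀ᶠ x : ℝ in Filter.cocompact ℝ, x ≠ 0 :=
      (isCompact_singleton (x := (0 : ℝ))).compl_mem_cocompact
    filter_upwards [this] with x hx
    have h1 := hB ((h * x : ℝ) : ℂ) (by simp [hd.le])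
    have hC : 0 ≤ C := by
      have := (norm_nonneg _).trans (hB 0 (by simp [hd.le]))
      simpa using this
    refine h1.trans ?_
    have : |x| ^ (-2 : ℝ) = 1 / x ^ 2 := by
      rw [Real.rpow_neg (abs_nonneg _)]
      norm_num
    rw [this, Real.norm_of_nonneg (by positivity), div_mul_div_comm, mul_one, Complex.ofReal_re,
      mul_pow]
    gcongr
    linarith
  -- The zero frequency is the integral itself; all the others make up the error.
  have hpois := Real.tsum_eq_tsum_fourier_of_rpow_decay_of_summable hcont one_lt_two hdecay hsumf 0
  have hfk : ∀ k : ℤ, f (0 + k) = F (k * h) := by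
    intro k
    simp [hf, mul_comm]
  simp only [hfk, QuotientAddGroup.mk_zero, fourier_eval_zero, mul_one] at hpois
  have h0 : 𝓕 g 0 = ∫ x : ℝ, F x := by
    rw [Real.fourier_real_eq_integral_exp_smul]
    simp [hg]
  rw [hpois, ← tsum_mul_left]
  simp only [hfour]
  rw [hsum.tsum_eq, h0]
  have e1 : ∀ S I T : ℂ, I - (S + I + T) = -(S + T) := by intros; ring
  rw [e1, norm_neg, mul_add, add_comm (_ * A)]
  exact (norm_add_le _ _).trans (add_le_add
    (tsum_of_norm_bounded (hgeo B) hBb) (tsum_of_norm_bounded (hgeo A) hA))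

/-- A functional of norm at most one that attains the norm of the error commutes with the integral
and the sum, so the scalar estimate suffices. -/
theorem norm_integral_sub_tsum_le_of_strip {E : Type*} [NormedAddCommGroup E] [NormedSpace ℂ E]
    [CompleteSpace E] {F : ℂ → E} {d h C : ℝ} (hd : 0 < d)
    (hh : 0 < h) (hF : ∀ w : ℂ, |w.im| ≤ d → DifferentiableAt ℂ F w)
    (hB : ∀ w : ℂ, |w.im| ≤ d → ‖F w‖ ≤ C / (1 + w.re ^ 2)) :
    ‖(∫ x : ℝ, F x) - (h : ℂ) • ∑' k : ℤ, F (k * h)‖ ≤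
      Real.exp (-(2 * Real.pi * d / h)) / (1 - Real.exp (-(2 * Real.pi * d / h))) *
        ((∫ x : ℝ, ‖F (x + d * Complex.I)‖) + ∫ x : ℝ, ‖F (x + (-d : ℝ) * Complex.I)‖) := by
  obtain ⟨φ, hφ, hφx⟩ := exists_dual_vector'' ℂ ((∫ x : ℝ, F x) - (h : ℂ) • ∑' k : ℤ, F (k * h))
  have hline : ∀ y : ℝ, |y| ≤ d → Integrable fun x : ℝ => F (x + y * Complex.I) := fun y hy =>
    integrable_horizontal (fun w hw => hF w (hw ▸ hy)) (fun w hw => hB w (hw ▸ hy))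
  have hle : ∀ v : E, ‖φ v‖ ≤ ‖v‖ := fun v => by
    simpa using φ.le_of_opNorm_le hφ v
  have hs : Summable fun k : ℤ => F (k * h) := by
    refine summable_of_norm_le_div_one_add_sq (C := C) hh fun k => ?_
    have := hB (k * h) (by simp [hd.le])
    simpa [mul_comm] using this
  have hscal := norm_integral_sub_tsum_le_of_strip_complex (F := fun w => φ (F w)) (C := C) hd hh
    (fun w hw => φ.differentiableAt.comp w (hF w hw)) (fun w hw => (hle _).trans (hB w hw))
  have h0 : Integrable fun x : ℝ => F x := by simpa using hline 0 (by simp [hd.le])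
  rw [φ.integral_comp_comm h0, ← φ.map_tsum hs, ← smul_eq_mul, ← map_smul, ← map_sub, hφx] at hscal
  simp only [Complex.coe_algebraMap, Complex.norm_real, norm_norm] at hscal
  refine hscal.trans ?_
  have hε1 : Real.exp (-(2 * Real.pi * d / h)) < 1 := by
    rw [Real.exp_lt_one_iff]
    have : 0 < 2 * Real.pi * d / h := by positivity
    linarith
  have hmono : ∀ y : ℝ, |y| ≤ d →
      ∫ x : ℝ, ‖φ (F (x + y * Complex.I))‖ ≤ ∫ x : ℝ, ‖F (x + y * Complex.I)‖ := fun y hy =>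
    integral_mono (φ.integrable_comp (hline y hy)).norm (hline y hy).norm fun x => hle _
  have : 0 < 1 - Real.exp (-(2 * Real.pi * d / h)) := by linarith
  exact mul_le_mul_of_nonneg_left
    (add_le_add (hmono d (abs_of_pos hd).le) (hmono (-d) (by simp [abs_of_pos hd])))
    (div_pos (Real.exp_pos _) this).le

end Trapezoidal

/-! ### Geometry of the sector -/

section Sector

variable {δ : ℝ}

/-- With `ψ = arg (-z)` the inequality reads `sin (|ψ| - δ) ≤ 0`, which for `0 ≤ |ψ| ≤ π` means `|ψ|
≤ δ`. In this form closedness and invariance under scaling are immediate. -/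
theorem mem_sector_iff (hδ : 0 < δ) (hδ' : δ < Real.pi / 2) (z : ℂ) :
    z ∈ sector δ ↔ |z.im| * Real.cos δ ≤ -z.re * Real.sin δ := by
  have hpi := Real.pi_pos
  rcases eq_or_ne z 0 with rfl | hz
  · simp [sector, hδ.le]
  set ψ := Complex.arg (-z) with hψ
  have hn : 0 < ‖z‖ := norm_pos_iff.2 hz
  have hre : -z.re = ‖z‖ * Real.cos |ψ| := by
    have := Complex.norm_mul_cos_arg (-z)
    rw [Real.cos_abs]
    simpa [hψ] using this.symm
  have him : |z.im| = ‖z‖ * Real.sin |ψ| := by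
    have := Complex.norm_mul_sin_arg (-z)
    rw [← Real.abs_sin_eq_sin_abs_of_abs_le_pi (Complex.abs_arg_le_pi _), ← abs_of_pos hn, ← abs_mul]
    simp only [norm_neg] at this
    rw [this]
    simp
  have h1 : 0 ≤ |ψ| := abs_nonneg _
  have h2 : |ψ| ≤ Real.pi := Complex.abs_arg_le_pi _
  have key : |z.im| * Real.cos δ ≤ -z.re * Real.sin δ ↔ Real.sin (|ψ| - δ) ≤ 0 := by
    rw [hre, him, Real.sin_sub, ← sub_nonpos]
    constructor
    · intro h
      have : ‖z‖ * (Real.sin |ψ| * Real.cos δ - Real.cos |ψ| * Real.sin δ) ≤ 0 := by linarith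
      exact nonpos_of_mul_nonpos_right this hn
    · intro h
      have := mul_nonpos_of_nonneg_of_nonpos hn.le h
      linarith
  rw [key]
  change |ψ| ≤ δ ↔ _
  constructor
  · intro h
    exact Real.sin_nonpos_of_nonpos_of_neg_pi_le (by linarith) (by linarith)
  · intro h
    by_contra hlt
    exact absurd (Real.sin_pos_of_pos_of_lt_pi (x := |ψ| - δ) (by linarith) (by linarith))
      (not_lt.2 h)

theorem isOpen_compl_sector (hδ : 0 < δ) (hδ' : δ < Real.pi / 2) : IsOpen (sector δ)ᶜ := by
  rw [isOpen_compl_iff]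
  have : sector δ = {z : ℂ | |z.im| * Real.cos δ ≤ -z.re * Real.sin δ} :=
    Set.ext fun z => mem_sector_iff hδ hδ' z
  rw [this]
  exact isClosed_le (by fun_prop) (by fun_prop)

theorem notMem_sector_of_re_pos (hδ : 0 < δ) (hδ' : δ < Real.pi / 2) {z : ℂ} (hz : 0 < z.re) :
    z ∉ sector δ := by
  rw [mem_sector_iff hδ hδ', not_le]
  have h1 : 0 < Real.sin δ := Real.sin_pos_of_pos_of_lt_pi hδ (by linarith)
  have h2 : 0 < Real.cos δ := Real.cos_pos_of_mem_Ioo ⟨by linarith, hδ'⟩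
  nlinarith [mul_pos hz h1, mul_nonneg (abs_nonneg z.im) h2.le]

theorem real_mul_notMem_sector (hδ : 0 < δ) (hδ' : δ < Real.pi / 2) {z : ℂ} (hz : z ∉ sector δ)
    {r : ℝ} (hr : 0 < r) : (r : ℂ) * z ∉ sector δ := by
  rw [mem_sector_iff hδ hδ'] at hz ⊢
  contrapose! hz
  simp only [Complex.mul_im, Complex.ofReal_re, Complex.ofReal_im, zero_mul, add_zero,
    Complex.mul_re, sub_zero, abs_mul, abs_of_pos hr] at hz
  refine le_of_mul_le_mul_left (?_ : r * _ ≤ r * _) hr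
  linarith

end Sector

/-! ### Geometry of the hyperbola -/

section Hyperbola

variable {α δ : ℝ} {w : ℂ}

/-- A shift of `w` by `i y` replaces the angle `α` by `α - y`; at `y = α` the hyperbola degenerates
to the vertical line `Re = 1`. -/
theorem hyperbolaMap_eq (α : ℝ) (w : ℂ) :
    hyperbolaMap α w = ((1 - Real.sin (α - w.im) * Real.cosh w.re : ℝ) : ℂ) +
      ((-(Real.cos (α - w.im) * Real.sinh w.re) : ℝ) : ℂ) * Complex.I := by
  have h : (α : ℂ) + Complex.I * w = ((α - w.im : ℝ) : ℂ) + (w.re : ℂ) * Complex.I := by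
    apply Complex.ext <;> simp [sub_eq_add_neg]
  rw [hyperbolaMap, h, Complex.sin_add, Complex.sin_mul_I, Complex.cos_mul_I]
  push_cast
  ring

theorem hyperbolaMap_re (α : ℝ) (w : ℂ) :
    (hyperbolaMap α w).re = 1 - Real.sin (α - w.im) * Real.cosh w.re := by
  rw [hyperbolaMap_eq]
  simp [-Complex.ofReal_sub, -Complex.ofReal_mul, -Complex.ofReal_neg]

theorem hyperbolaMap_im (α : ℝ) (w : ℂ) :
    (hyperbolaMap α w).im = -(Real.cos (α - w.im) * Real.sinh w.re) := by
  rw [hyperbolaMap_eq]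
  simp [-Complex.ofReal_sub, -Complex.ofReal_mul, -Complex.ofReal_neg]

theorem hasDerivAt_hyperbolaMap (α : ℝ) (w : ℂ) :
    HasDerivAt (hyperbolaMap α) (-(Complex.cos (α + Complex.I * w) * Complex.I)) w := by
  have h : HasDerivAt (fun w : ℂ => (α : ℂ) + Complex.I * w) Complex.I w := by
    simpa using ((hasDerivAt_id w).const_mul Complex.I).const_add (α : ℂ)
  exact (h.csin).const_sub 1

theorem deriv_hyperbolaMap (α : ℝ) :
    deriv (hyperbolaMap α) = fun w => -(Complex.cos (α + Complex.I * w) * Complex.I) :=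
  funext fun w => (hasDerivAt_hyperbolaMap α w).deriv

theorem differentiable_hyperbolaMap (α : ℝ) : Differentiable ℂ (hyperbolaMap α) :=
  fun w => (hasDerivAt_hyperbolaMap α w).differentiableAt

/-- The origin is a focus of the hyperbola, so the distance to it is affine in `cosh`. -/
theorem norm_hyperbolaMap (α : ℝ) (w : ℂ) :
    ‖hyperbolaMap α w‖ = Real.cosh w.re - Real.sin (α - w.im) := by
  have h0 : 0 ≤ Real.cosh w.re - Real.sin (α - w.im) := by
    linarith [Real.one_le_cosh w.re, Real.sin_le_one (α - w.im)]
  rw [← sq_eq_sq₀ (norm_nonneg _) h0, Complex.sq_norm, Complex.normSq_apply, hyperbolaMap_re,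
    hyperbolaMap_im]
  nlinarith [Real.sin_sq_add_cos_sq (α - w.im), Real.cosh_sq w.re]

/-- The two factors are the distances of `T` to the foci `0` and `2`, since `|T'|² = |T| |2 - T|`.
-/
theorem norm_deriv_hyperbolaMap_sq (α : ℝ) (w : ℂ) :
    ‖deriv (hyperbolaMap α) w‖ ^ 2 =
      (Real.cosh w.re - Real.sin (α - w.im)) * (Real.cosh w.re + Real.sin (α - w.im)) := by
  have h : (α : ℂ) + Complex.I * w = ((α - w.im : ℝ) : ℂ) + (w.re : ℂ) * Complex.I := by
    apply Complex.ext <;> simp [sub_eq_add_neg]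
  rw [deriv_hyperbolaMap, norm_neg, norm_mul, Complex.norm_I, mul_one, h, Complex.cos_add,
    Complex.sin_mul_I, Complex.cos_mul_I]
  have : Complex.cos ((α - w.im : ℝ) : ℂ) * Complex.cosh (w.re : ℂ) -
      Complex.sin ((α - w.im : ℝ) : ℂ) * (Complex.sinh (w.re : ℂ) * Complex.I) =
      ((Real.cos (α - w.im) * Real.cosh w.re : ℝ) : ℂ) +
        ((-(Real.sin (α - w.im) * Real.sinh w.re) : ℝ) : ℂ) * Complex.I := by
    push_cast
    ring
  rw [this, Complex.sq_norm, Complex.normSq_add_mul_I]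
  nlinarith [Real.sin_sq_add_cos_sq (α - w.im), Real.cosh_sq w.re]

/-- `|T' / T|` is controlled by its value at the vertex of the hyperbola. -/
theorem norm_deriv_hyperbolaMap_le {β : ℝ} (h0 : 0 ≤ α - w.im) (hβ : α - w.im ≤ β)
    (hβ' : β < Real.pi / 2) :
    ‖deriv (hyperbolaMap α) w‖ ≤
      √((1 + Real.sin β) / (1 - Real.sin β)) * ‖hyperbolaMap α w‖ := by
  have hpi := Real.pi_pos
  set s := Real.sin (α - w.im) with hs
  have hsβ : s ≤ Real.sin β := Real.sin_le_sin_of_le_of_le_pi_div_two (by linarith) hβ'.le hβ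
  have hs0 : 0 ≤ s := Real.sin_nonneg_of_nonneg_of_le_pi h0 (by linarith)
  have hβ1 : Real.sin β < 1 := by
    rw [← Real.sin_pi_div_two]
    exact Real.sin_lt_sin_of_lt_of_le_pi_div_two (by linarith) le_rfl hβ'
  have hc := Real.one_le_cosh w.re
  rw [← sq_le_sq₀ (norm_nonneg _) (by positivity), mul_pow, Real.sq_sqrt
    (div_nonneg (by linarith) (by linarith)), norm_deriv_hyperbolaMap_sq, norm_hyperbolaMap,
    div_mul_eq_mul_div, le_div_iff₀ (by linarith), ← hs]
  have h1 : 0 ≤ Real.cosh w.re - s := by linarith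
  -- After expansion this is `s ≤ sin β * cosh`.
  have : (Real.cosh w.re + s) * (1 - Real.sin β) ≤ (1 + Real.sin β) * (Real.cosh w.re - s) := by
    nlinarith [mul_nonneg (by linarith : 0 ≤ Real.cosh w.re - 1) (by linarith : 0 ≤ Real.sin β)]
  nlinarith [mul_le_mul_of_nonneg_left this h1]

/-- With `β = α - Im w` and `x = |Re w|`, the claim is `(sin β cosh x - 1) sin δ < cos β cos δ sinh
x`. It follows from `sin β (cosh x - sinh x) ≤ 1` and from `cos (β + δ) > 0`, that is `sin β sin δ <
cos β cos δ`; at `x = 0` strictness comes from `sin β < 1`. -/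
theorem hyperbolaMap_notMem_sector (hδ : 0 < δ) (hδ' : δ < Real.pi / 2) (h0 : 0 ≤ α - w.im)
    (h1 : α - w.im < Real.pi / 2 - δ) : hyperbolaMap α w ∉ sector δ := by
  have hpi := Real.pi_pos
  rw [mem_sector_iff hδ hδ', not_le, hyperbolaMap_re, hyperbolaMap_im, abs_neg, abs_mul,
    Real.abs_sinh]
  set β := α - w.im
  have hs0 : 0 ≤ Real.sin β := Real.sin_nonneg_of_nonneg_of_le_pi h0 (by linarith)
  have hs1 : Real.sin β ≤ 1 := Real.sin_le_one _
  have hcβ : 0 < Real.cos β := Real.cos_pos_of_mem_Ioo ⟨by linarith, by linarith⟩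
  have hsδ : 0 < Real.sin δ := Real.sin_pos_of_pos_of_lt_pi hδ (by linarith)
  have hcδ : 0 < Real.cos δ := Real.cos_pos_of_mem_Ioo ⟨by linarith, hδ'⟩
  have hcos : 0 < Real.cos (β + δ) := Real.cos_pos_of_mem_Ioo ⟨by linarith, by linarith⟩
  rw [Real.cos_add] at hcos
  rw [abs_of_pos hcβ, ← Real.cosh_abs w.re]
  set x := |w.re|
  have hx : 0 ≤ x := abs_nonneg _
  have hsh : 0 ≤ Real.sinh x := Real.sinh_nonneg_iff.2 hx
  have hcs : Real.cosh x - Real.sinh x ≤ 1 := by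
    rw [Real.cosh_sub_sinh, Real.exp_le_one_iff]
    linarith
  have e1 : Real.sin β * Real.sin δ * Real.sinh x ≤ Real.cos β * Real.cos δ * Real.sinh x :=
    mul_le_mul_of_nonneg_right (by linarith) hsh
  have e2 : Real.sin β * (Real.cosh x - Real.sinh x) ≤ 1 :=
    mul_le_one₀ hs1 (by linarith [Real.sinh_lt_cosh x]) hcs
  rcases hx.eq_or_lt with h | h
  · have hβ1 : Real.sin β < 1 := by
      rw [← Real.sin_pi_div_two]
      exact Real.sin_lt_sin_of_lt_of_le_pi_div_two (by linarith) le_rfl (by linarith)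
    rw [← h]
    simp only [Real.cosh_zero, Real.sinh_zero]
    nlinarith
  · have e3 : Real.sin β * Real.sin δ * Real.sinh x < Real.cos β * Real.cos δ * Real.sinh x :=
      mul_lt_mul_of_pos_right (by linarith) (Real.sinh_pos_iff.2 h)
    nlinarith [mul_le_mul_of_nonneg_right e2 hsδ.le]

theorem one_add_sq_div_four_le_cosh (x : ℝ) : (1 + x ^ 2) / 4 ≤ Real.cosh x := by
  rw [← Real.cosh_abs, ← sq_abs, Real.cosh_eq]
  have h1 := Real.quadratic_le_exp_of_nonneg (abs_nonneg x)
  have h2 := Real.add_one_le_exp (-|x|)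
  linarith

/-- Weakens the doubly exponential decay to the quadratic decay assumed in the strip lemmas. -/
theorem exp_neg_mul_cosh_le {γ : ℝ} (hγ : 0 < γ) (x : ℝ) :
    Real.exp (-(γ * Real.cosh x)) ≤ 4 / γ / (1 + x ^ 2) := by
  have hc := one_add_sq_div_four_le_cosh x
  have h1 := Real.add_one_le_exp (γ * Real.cosh x)
  have h2 : γ * ((1 + x ^ 2) / 4) ≤ γ * Real.cosh x := by gcongr
  rw [Real.exp_neg, div_div, inv_le_comm₀ (Real.exp_pos _) (by positivity), inv_div]
  linarith

end Hyperbola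

/-! ### Bounds and holomorphy of the integrand -/

section Integrand

variable {X : Type*} [NormedAddCommGroup X] [NormedSpace ℂ X] {U : ℂ → X} {α δ M lam t : ℝ} {w : ℂ}

/-- The bound `M / (λ |T|)` for `U` cancels `λ |T'|` up to the ratio `|T'| / |T|`, so `λ` survives
only in the exponential. -/
theorem norm_inversionIntegrand_le (hδ : 0 < δ) (hδ' : δ < Real.pi / 2) (hlam : 0 < lam)
    (hbound : ∀ z : ℂ, z ∉ sector δ → ‖U z‖ ≤ M / ‖z‖) {β : ℝ}
    (h0 : 0 ≤ α - w.im) (hβ : α - w.im ≤ β) (hβ' : β < Real.pi / 2 - δ) :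
    ‖inversionIntegrand U α lam t w‖ ≤
      M / (2 * Real.pi) * √((1 + Real.sin β) / (1 - Real.sin β)) *
        Real.exp (lam * t * (1 - Real.sin (α - w.im) * Real.cosh w.re)) := by
  have hT := hyperbolaMap_notMem_sector hδ hδ' h0 (hβ.trans_lt hβ')
  have hTn : 0 < ‖hyperbolaMap α w‖ := by
    rw [norm_pos_iff]
    rintro h
    exact hT (h ▸ by simp [sector, hδ.le])
  have hU := hbound _ (real_mul_notMem_sector hδ hδ' hT hlam)
  have hD := norm_deriv_hyperbolaMap_le h0 hβ (by linarith)
  set R := √((1 + Real.sin β) / (1 - Real.sin β))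
  have hexp : ‖Complex.exp (lam * t * hyperbolaMap α w)‖ =
      Real.exp (lam * t * (1 - Real.sin (α - w.im) * Real.cosh w.re)) := by
    rw [Complex.norm_exp, ← Complex.ofReal_mul, Complex.re_ofReal_mul, hyperbolaMap_re]
  have hc : ‖-((lam : ℂ) / (2 * (Real.pi : ℂ) * Complex.I))‖ = lam / (2 * Real.pi) := by
    simp [abs_of_pos hlam, abs_of_pos Real.pi_pos]
  rw [inversionIntegrand, norm_smul, norm_mul, norm_mul, hexp, hc]
  rw [norm_mul, Complex.norm_real, Real.norm_of_nonneg hlam.le] at hU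
  calc _ ≤ lam / (2 * Real.pi) * Real.exp (lam * t * (1 - Real.sin (α - w.im) * Real.cosh w.re)) *
        (R * ‖hyperbolaMap α w‖) * (M / (lam * ‖hyperbolaMap α w‖)) := by
        have := Real.pi_pos
        gcongr
    _ = _ := by field_simp

theorem differentiableAt_comp_hyperbolaMap (hδ : 0 < δ) (hδ' : δ < Real.pi / 2)
    (hlam : 0 < lam) (hU : DifferentiableOn ℂ U (sector δ)ᶜ)
    (h0 : 0 ≤ α - w.im) (h1 : α - w.im < Real.pi / 2 - δ) :
    DifferentiableAt ℂ (fun w => U (lam * hyperbolaMap α w)) w := by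
  have hT := real_mul_notMem_sector hδ hδ' (hyperbolaMap_notMem_sector hδ hδ' h0 h1) hlam
  have hUd : DifferentiableAt ℂ U (lam * hyperbolaMap α w) :=
    (hU _ hT).differentiableAt ((isOpen_compl_sector hδ hδ').mem_nhds hT)
  exact hUd.comp w ((differentiable_hyperbolaMap α w).const_mul _)

theorem differentiable_deriv_hyperbolaMap (α : ℝ) :
    Differentiable ℂ (deriv (hyperbolaMap α)) := by
  rw [deriv_hyperbolaMap]
  fun_prop

theorem differentiableAt_inversionIntegrand (hδ : 0 < δ) (hδ' : δ < Real.pi / 2)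
    (hlam : 0 < lam) (hU : DifferentiableOn ℂ U (sector δ)ᶜ)
    (h0 : 0 ≤ α - w.im) (h1 : α - w.im < Real.pi / 2 - δ) :
    DifferentiableAt ℂ (inversionIntegrand U α lam t) w := by
  have hT := differentiable_hyperbolaMap α w
  have hT' := differentiable_deriv_hyperbolaMap α w
  refine DifferentiableAt.smul ?_ (differentiableAt_comp_hyperbolaMap hδ hδ' hlam hU h0 h1)
  fun_prop

end Integrand

/-! ### Transforms of test functions and Parseval's identity -/

section BilateralLaplace

/-- The bilateral Laplace transform `∫ g(t) e^{ζ t} dt` (with the sign convention `e^{+ζ t}`). -/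
noncomputable def bilateralLaplace (g : ℝ → ℂ) (ζ : ℂ) : ℂ := ∫ t : ℝ, g t * Complex.exp (ζ * t)

variable {g : ℝ → ℂ}

theorem integrable_mul_exp (hg : Continuous g) (hs : HasCompactSupport g) (ζ : ℂ) :
    Integrable fun t : ℝ => g t * Complex.exp (ζ * t) :=
  (by fun_prop : Continuous fun t : ℝ => g t * Complex.exp (ζ * t)).integrable_of_hasCompactSupport
    hs.mul_right

theorem differentiable_bilateralLaplace (hg : Continuous g) (hs : HasCompactSupport g) :
    Differentiable ℂ (bilateralLaplace g) := by
  intro ζ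
  refine (hasDerivAt_integral_of_dominated_loc_of_deriv_le (𝕜 := ℂ) (μ := volume)
    (F := fun ζ t => g t * Complex.exp (ζ * t))
    (F' := fun ζ t => g t * (t * Complex.exp (ζ * t)))
    (bound := fun t => ‖g t‖ * (|t| * Real.exp ((‖ζ‖ + 1) * |t|)))
    (Metric.ball_mem_nhds ζ one_pos) (.of_forall fun z => ?_) (integrable_mul_exp hg hs ζ) ?_
    (.of_forall fun t z hz => ?_) ?_ (.of_forall fun t z _ => ?_)).2.differentiableAt
  · exact (integrable_mul_exp hg hs z).aestronglyMeasurable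
  · exact (by fun_prop : Continuous fun t : ℝ => g t * (t * Complex.exp (ζ * t))).aestronglyMeasurable
  · rw [norm_mul, norm_mul, Complex.norm_real, Complex.norm_exp, Real.norm_eq_abs]
    have hz' : ‖z‖ ≤ ‖ζ‖ + 1 := by
      have h1 : ‖z - ζ‖ < 1 := by simpa [dist_eq_norm] using hz
      have h2 := norm_le_norm_add_norm_sub' z ζ
      linarith
    have : (z * t).re ≤ (‖ζ‖ + 1) * |t| :=
      (Complex.re_le_norm _).trans (by rw [norm_mul, Complex.norm_real, Real.norm_eq_abs]; gcongr)
    gcongr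
  · exact (by fun_prop : Continuous fun t : ℝ => ‖g t‖ * (|t| * Real.exp ((‖ζ‖ + 1) * |t|)))
      |>.integrable_of_hasCompactSupport hs.norm.mul_right
  · have h : HasDerivAt (fun z : ℂ => z * t) (t : ℂ) z := by
      simpa using (hasDerivAt_id z).mul_const (t : ℂ)
    have := h.cexp.const_mul (g t)
    simpa [mul_comm, mul_left_comm] using this

theorem norm_bilateralLaplace_le (hg : Continuous g) (hs : HasCompactSupport g)
    (hpos : tsupport g ⊆ Ioi 0) {ζ : ℂ} {c : ℝ} (hζ : ζ.re ≤ c) :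
    ‖bilateralLaplace g ζ‖ ≤ ∫ t : ℝ, ‖g t‖ * Real.exp (c * t) := by
  refine norm_integral_le_of_norm_le ?_ (.of_forall fun t => ?_)
  · exact (by fun_prop : Continuous fun t : ℝ => ‖g t‖ * Real.exp (c * t))
      |>.integrable_of_hasCompactSupport hs.norm.mul_right
  · rw [norm_mul, Complex.norm_exp]
    by_cases ht : t ∈ tsupport g
    · have ht0 : 0 < t := hpos ht
      have : (ζ * t).re ≤ c * t := by
        simp only [Complex.re_mul_ofReal]
        gcongr
      gcongr
    · simp [image_eq_zero_of_notMem_tsupport ht]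

/-- Integration by parts without boundary terms; this is the source of the decay `1 / |ζ|`. -/
theorem mul_bilateralLaplace (hg : ContDiff ℝ 1 g) (hs : HasCompactSupport g) (ζ : ℂ) :
    ζ * bilateralLaplace g ζ = -bilateralLaplace (deriv g) ζ := by
  have hg' : Continuous (deriv g) := hg.continuous_deriv le_rfl
  have hd : ∀ t : ℝ, HasDerivAt (fun t : ℝ => g t * Complex.exp (ζ * t))
      (deriv g t * Complex.exp (ζ * t) + ζ * (g t * Complex.exp (ζ * t))) t := by
    intro t
    have h1 : HasDerivAt g (deriv g t) t := (hg.differentiable one_ne_zero t).hasDerivAt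
    have h2 : HasDerivAt (fun t : ℝ => ζ * (t : ℂ)) ζ t := by
      simpa using (Complex.ofRealCLM.hasDerivAt (x := t)).const_mul ζ
    exact (h1.mul h2.cexp).congr_deriv (by ring)
  have i1 := integrable_mul_exp hg' hs.deriv ζ
  have i2 := (integrable_mul_exp hg.continuous hs ζ).const_mul ζ
  have := integral_eq_zero_of_hasDerivAt_of_integrable hd (i1.add i2)
    (integrable_mul_exp hg.continuous hs ζ)
  rw [integral_add i1 i2, integral_const_mul] at this
  rw [bilateralLaplace, bilateralLaplace]
  linear_combination this

/-- On half planes bounded on the right, the transform of a test function supported in `(0, ∞)`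
decays at infinity. -/
theorem exists_norm_mul_bilateralLaplace_le (hg : ContDiff ℝ 1 g) (hs : HasCompactSupport g)
    (hpos : tsupport g ⊆ Ioi 0) (c : ℝ) :
    ∃ N, 0 ≤ N ∧ ∀ ζ : ℂ, ζ.re ≤ c → ‖ζ‖ * ‖bilateralLaplace g ζ‖ ≤ N := by
  refine ⟨∫ t : ℝ, ‖deriv g t‖ * Real.exp (c * t), integral_nonneg fun t => by positivity,
    fun ζ hζ => ?_⟩
  rw [← norm_mul, mul_bilateralLaplace hg hs, norm_neg]
  exact norm_bilateralLaplace_le (hg.continuous_deriv le_rfl) hs.deriv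
    ((closure_minimal support_deriv_subset (isClosed_tsupport g)).trans hpos) hζ

open FourierTransform ContDiff in
/-- Parseval's identity for a Laplace transform on a vertical line. -/
theorem integral_bilateralLaplace_smul_eq {X : Type*} [NormedAddCommGroup X] [NormedSpace ℂ X]
    [CompleteSpace X] (hg : ContDiff ℝ ∞ g) (hs : HasCompactSupport g)
    (hpos : tsupport g ⊆ Ioi 0) {u : ℝ → X} {c : ℝ}
    (hu : IntegrableOn (fun t : ℝ => Real.exp (-(c * t)) • u t) (Ioi 0)) :
    ∫ s : ℝ, bilateralLaplace g (c - s * Complex.I) •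
        (∫ t in Ioi (0 : ℝ), Complex.exp (-((c - s * Complex.I) * (t : ℂ))) • u t) =
      (2 * Real.pi) • ∫ t : ℝ, g t • u t := by
  -- The weights in `f` and `G` cancel, so that `G f = g u`, while `f` is integrable and `G` is a
  -- Schwartz function. Then the Fourier transform can be moved from `𝓕⁻ G` to `f`.
  set f : ℝ → X := (Ioi (0 : ℝ)).indicator fun t => Real.exp (-(c * t)) • u t with hf
  have hfi : Integrable f := hu.integrable_indicator measurableSet_Ioi
  set G : ℝ → ℂ := fun t => g t * Complex.exp (c * t) with hG
  have hGs : HasCompactSupport G := hs.mul_right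
  have hGc : ContDiff ℝ ∞ G := by
    refine hg.mul ?_
    have : ContDiff ℝ ∞ fun t : ℝ => (c : ℂ) * t := contDiff_const.mul Complex.ofRealCLM.contDiff
    exact this.cexp
  set S : SchwartzMap ℝ ℂ := hGs.toSchwartzMap (hGc) with hS
  have hSG : (S : ℝ → ℂ) = G := rfl
  have hR : Integrable (𝓕⁻ G) := by
    have := (𝓕⁻ S).integrable (μ := volume)
    rwa [SchwartzMap.fourierInv_coe, hSG] at this
  have hinv : 𝓕 (𝓕⁻ G) = G := by
    have := S.continuous.fourier_fourierInv_eq S.integrable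
    rw [hSG] at this
    refine this ?_
    have := (𝓕 S).integrable (μ := volume)
    rwa [SchwartzMap.fourier_coe, hSG] at this
  have hflip : ∫ ξ : ℝ, 𝓕 (𝓕⁻ G) ξ • f ξ = ∫ x : ℝ, (𝓕⁻ G) x • 𝓕 f x := by
    simpa using! (VectorFourier.integral_fourierIntegral_smul_eq_flip (L := innerₗ ℝ)
      Real.continuous_fourierChar continuous_inner hR hfi)
  have hGf : ∀ t : ℝ, G t • f t = g t • u t := by
    intro t
    by_cases ht : t ∈ Ioi (0 : ℝ)
    · simp only [hG, hf, indicator_of_mem ht]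
      rw [← Complex.coe_smul, smul_smul, mul_assoc, Complex.ofReal_exp, ← Complex.exp_add]
      simp
    · have : g t = 0 := image_eq_zero_of_notMem_tsupport fun h => ht (hpos h)
      simp [hG, this]
  -- The substitution `s = -2πξ` is the origin of the factor `2π`.
  have hLap : ∀ ξ : ℝ, (𝓕⁻ G) ξ = bilateralLaplace g (c - (-(2 * Real.pi) * ξ : ℝ) * Complex.I) := by
    intro ξ
    rw [Real.fourierInv_eq', bilateralLaplace]
    congr 1
    ext t
    simp only [hG, smul_eq_mul]
    rw [mul_comm, mul_assoc, ← Complex.exp_add]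
    congr 2
    simp
    ring
  have hUf : ∀ ξ : ℝ, 𝓕 f ξ = ∫ t in Ioi (0 : ℝ),
      Complex.exp (-((c - (-(2 * Real.pi) * ξ : ℝ) * Complex.I) * (t : ℂ))) • u t := by
    intro ξ
    rw [Real.fourier_real_eq_integral_exp_smul, ← integral_indicator measurableSet_Ioi]
    congr 1
    ext t
    by_cases ht : t ∈ Ioi (0 : ℝ)
    · simp only [hf, indicator_of_mem ht]
      rw [← Complex.coe_smul, smul_smul, Complex.ofReal_exp, ← Complex.exp_add]
      congr 2
      push_cast
      ring
    · simp only [hf, indicator_of_notMem ht, smul_zero]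
  rw [hinv] at hflip
  simp only [hGf, hLap, hUf] at hflip
  rw [hflip, Measure.integral_comp_mul_left (fun s : ℝ => bilateralLaplace g (c - s * Complex.I) •
        (∫ t in Ioi (0 : ℝ), Complex.exp (-((c - s * Complex.I) * (t : ℂ))) • u t))]
  rw [smul_smul, abs_inv, abs_neg, abs_of_pos Real.two_pi_pos, mul_inv_cancel₀ Real.two_pi_pos.ne',
    one_smul]

end BilateralLaplace

/-! ### The contour integral represents `u` -/

section Inversion

variable {X : Type*} [NormedAddCommGroup X] [NormedSpace ℂ X] {U : ℂ → X} {α δ M lam : ℝ}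

/-- The inverse Laplace transform as an integral over a branch of a hyperbola. -/
noncomputable def hyperbolicInverse (U : ℂ → X) (α lam t : ℝ) : X :=
  ∫ x : ℝ, inversionIntegrand U α lam t x

/-- Quadratic decay of the integrand, uniformly for `t` in a compact interval. -/
theorem norm_inversionIntegrand_le_div (hδ : 0 < δ) (hδ' : δ < Real.pi / 2)
    (hlam : 0 < lam) (hM : 0 ≤ M)
    (hbound : ∀ z : ℂ, z ∉ sector δ → ‖U z‖ ≤ M / ‖z‖) {β₁ β₂ t₁ t₂ : ℝ} (hβ₁ : 0 < β₁)
    (hβ₂ : β₂ < Real.pi / 2 - δ) (ht₁ : 0 < t₁) {t : ℝ} (ht : t ∈ Icc t₁ t₂) {w : ℂ}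
    (hw : α - w.im ∈ Icc β₁ β₂) :
    ‖inversionIntegrand U α lam t w‖ ≤
      M / (2 * Real.pi) * √((1 + Real.sin β₂) / (1 - Real.sin β₂)) *
        (Real.exp (lam * t₂) * (4 / (lam * t₁ * Real.sin β₁))) / (1 + w.re ^ 2) := by
  have hpi := Real.pi_pos
  have h12 := hw.1.trans hw.2
  have hs : 0 < Real.sin β₁ := Real.sin_pos_of_pos_of_lt_pi hβ₁ (by linarith)
  have hs' : Real.sin β₁ ≤ Real.sin (α - w.im) :=
    Real.sin_le_sin_of_le_of_le_pi_div_two (by linarith) (by linarith [hw.2]) hw.1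
  have hc := Real.cosh_pos w.re
  refine (norm_inversionIntegrand_le hδ hδ' hlam hbound (hβ₁.le.trans hw.1) hw.2 hβ₂).trans ?_
  rw [mul_div_assoc, mul_div_assoc]
  have : Real.exp (lam * t * (1 - Real.sin (α - w.im) * Real.cosh w.re)) ≤
      Real.exp (lam * t₂) * Real.exp (-(lam * t₁ * Real.sin β₁ * Real.cosh w.re)) := by
    rw [← Real.exp_add, Real.exp_le_exp]
    have h1 : lam * t ≤ lam * t₂ := by gcongr; exact ht.2
    have h2 : lam * t₁ * Real.sin β₁ * Real.cosh w.re ≤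
        lam * t * Real.sin (α - w.im) * Real.cosh w.re := by
      have h3 := ht.1
      have h4 : 0 ≤ lam * t := mul_nonneg hlam.le (ht₁.le.trans h3)
      gcongr
    linarith
  gcongr
  exact this.trans (by gcongr; exact exp_neg_mul_cosh_le (by positivity) _)

theorem continuous_inversionIntegrand (hδ : 0 < δ) (hδ' : δ < Real.pi / 2)
    (hlam : 0 < lam) (hU : DifferentiableOn ℂ U (sector δ)ᶜ)
    (h0 : 0 ≤ α) (h1 : α < Real.pi / 2 - δ) :
    Continuous fun p : ℝ × ℝ => inversionIntegrand U α lam p.1 p.2 := by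
  have hUc : Continuous fun x : ℝ => U (lam * hyperbolaMap α x) := by
    simpa using continuous_horizontal (y := 0) (F := fun w => U (lam * hyperbolaMap α w))
      fun w hw => differentiableAt_comp_hyperbolaMap hδ hδ' hlam hU (by simpa [hw]) (by simpa [hw])
  have hT := (differentiable_hyperbolaMap α).continuous
  have hT' := (differentiable_deriv_hyperbolaMap α).continuous
  unfold inversionIntegrand
  exact Continuous.smul (by fun_prop) (hUc.comp continuous_snd)

theorem continuousOn_hyperbolicInverse (hδ : 0 < δ) (hδ' : δ < Real.pi / 2)
    (hlam : 0 < lam) (hM : 0 ≤ M) (hU : DifferentiableOn ℂ U (sector δ)ᶜ)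
    (hbound : ∀ z : ℂ, z ∉ sector δ → ‖U z‖ ≤ M / ‖z‖)
    (h0 : 0 < α) (h1 : α < Real.pi / 2 - δ) :
    ContinuousOn (hyperbolicInverse U α lam) (Ioi 0) := by
  intro t (ht : 0 < t)
  refine ContinuousAt.continuousWithinAt ?_
  have hc := continuous_inversionIntegrand hδ hδ' hlam hU h0.le h1
  refine continuousAt_of_dominated (.of_forall fun s => ?_) ?_
    (integrable_const_div_one_add_sq
      (M / (2 * Real.pi) * √((1 + Real.sin α) / (1 - Real.sin α)) *
        (Real.exp (lam * (2 * t)) * (4 / (lam * (t / 2) * Real.sin α)))))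
    (.of_forall fun x => ?_)
  · exact (hc.comp (by fun_prop : Continuous fun x : ℝ => (s, x))).aestronglyMeasurable
  · filter_upwards [Icc_mem_nhds (by linarith : t / 2 < t) (by linarith : t < 2 * t)] with s hs
    refine .of_forall fun x => ?_
    have := norm_inversionIntegrand_le_div hδ hδ' hlam hM hbound h0 h1 (half_pos ht) hs
      (α := α) (w := x) (by simp)
    simpa using this
  · exact (hc.comp (by fun_prop : Continuous fun s : ℝ => (s, x))).continuousAt

theorem integrable_smul_of_tsupport_subset {f : ℝ → X} {g : ℝ → ℝ} {s : Set ℝ}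
    (hf : LocallyIntegrableOn f s) (hg : Continuous g) (hs : HasCompactSupport g)
    (hgs : tsupport g ⊆ s) : Integrable fun t => g t • f t := by
  have h : IntegrableOn (fun t => g t • f t) (tsupport g) :=
    (hf.integrableOn_compact_subset hgs hs).continuousOn_smul hg.continuousOn hs
  refine (integrableOn_iff_integrable_of_support_subset fun t ht => ?_).1 h
  refine subset_tsupport g fun h0 => ht ?_
  simp [h0]

variable [CompleteSpace X] {g : ℝ → ℂ}

/-- Pairing the inverse with a test function and deforming the contour to a vertical line. -/
theorem integral_smul_hyperbolicInverse (hδ : 0 < δ) (hδ' : δ < Real.pi / 2)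
    (hlam : 0 < lam) (hM : 0 ≤ M) (hU : DifferentiableOn ℂ U (sector δ)ᶜ)
    (hbound : ∀ z : ℂ, z ∉ sector δ → ‖U z‖ ≤ M / ‖z‖)
    (h0 : 0 < α) (h1 : α < Real.pi / 2 - δ) (hg : ContDiff ℝ 1 g) (hs : HasCompactSupport g)
    (hpos : tsupport g ⊆ Ioi 0) :
    (2 * Real.pi) • ∫ t : ℝ, g t • hyperbolicInverse U α lam t =
      ∫ s : ℝ, bilateralLaplace g (lam - s * Complex.I) • U (lam - s * Complex.I) := by
  have hpi := Real.pi_pos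
  obtain ⟨N, hN, hNb⟩ := exists_norm_mul_bilateralLaplace_le hg hs hpos lam
  have hdg := differentiable_bilateralLaplace hg.continuous hs
  -- Fubini applies because the support of `g` stays away from `0` and `∞`, where the decay of the
  -- integrand is not uniform in `t`.
  have hswap : ∫ t : ℝ, g t • hyperbolicInverse U α lam t =
      ∫ x : ℝ, ∫ t : ℝ, g t • inversionIntegrand U α lam t x := by
    simp only [hyperbolicInverse, ← integral_smul]
    refine integral_integral_swap ?_
    have hc := continuous_inversionIntegrand hδ hδ' hlam hU h0.le h1
    rcases (tsupport g).eq_empty_or_nonempty with he | hne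
    · have : g = 0 := tsupport_eq_empty_iff.1 he
      simp [this, Function.uncurry_def]
    obtain ⟨t₁, ht₁, ht₁'⟩ := hs.isCompact.exists_isLeast hne
    obtain ⟨t₂, ht₂, ht₂'⟩ := hs.isCompact.exists_isGreatest hne
    have hgi : Integrable g := hg.continuous.integrable_of_hasCompactSupport hs
    refine (hgi.norm.mul_prod (integrable_const_div_one_add_sq
      (M / (2 * Real.pi) * √((1 + Real.sin α) / (1 - Real.sin α)) *
        (Real.exp (lam * t₂) * (4 / (lam * t₁ * Real.sin α)))))).mono' ?_ (.of_forall ?_)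
    · exact ((hg.continuous.comp continuous_fst).smul hc).aestronglyMeasurable
    · rintro ⟨t, x⟩
      simp only [Function.uncurry_apply_pair, norm_smul]
      by_cases ht : t ∈ tsupport g
      · have := norm_inversionIntegrand_le_div hδ hδ' hlam hM hbound h0 h1
          (hpos ht₁) ⟨ht₁' ht, ht₂' ht⟩ (α := α) (w := x) (by simp)
        simp only [Complex.ofReal_re] at this
        gcongr
      · simp [image_eq_zero_of_notMem_tsupport ht]
  -- The decay of `Φ` comes from `bilateralLaplace g` and `U`, no longer from `sin (α - Im w) > 0`.
  -- This permits a shift up to `Im w = α`, where the sine vanishes.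
  set Φ : ℂ → X := fun w => (-((lam : ℂ) / (2 * (Real.pi : ℂ) * Complex.I)) *
    bilateralLaplace g (lam * hyperbolaMap α w) * deriv (hyperbolaMap α) w) •
      U (lam * hyperbolaMap α w) with hΦ
  have hinner : ∀ x : ℝ, ∫ t : ℝ, g t • inversionIntegrand U α lam t x = Φ (x + (0 : ℝ) * Complex.I) := by
    intro x
    simp only [inversionIntegrand, smul_smul, Complex.ofReal_zero, zero_mul, add_zero, hΦ]
    rw [integral_smul_const, bilateralLaplace, ← integral_const_mul, ← integral_mul_const]
    congr 2
    ext t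
    rw [show (lam : ℂ) * t * hyperbolaMap α x = lam * hyperbolaMap α x * t by ring]
    ring
  have hsα : Real.sin α < 1 := by
    rw [← Real.sin_pi_div_two]
    exact Real.sin_lt_sin_of_lt_of_le_pi_div_two (by linarith) le_rfl (by linarith)
  set R := √((1 + Real.sin α) / (1 - Real.sin α)) with hR
  have hshift : ∫ x : ℝ, Φ (x + (0 : ℝ) * Complex.I) = ∫ x : ℝ, Φ (x + α * Complex.I) := by
    refine integral_horizontal_eq
      -- Collects `λ/2π`, `|T'| ≤ R |T|`, the bounds `N / (λ|T|)` and `M / (λ|T|)`, and `|T| ≥ (1 -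
      -- sin α)(1 + x²)/4`.
      (C := lam / (2 * Real.pi) * R * M * N * (4 / (lam ^ 2 * (1 - Real.sin α)))) h0.le
      (fun w hw => ?_) (fun w hw => ?_)
    · have hT := differentiable_hyperbolaMap α w
      have hT' := differentiable_deriv_hyperbolaMap α w
      have hL : DifferentiableAt ℂ (fun w => bilateralLaplace g (lam * hyperbolaMap α w)) w :=
        (hdg _).comp w (hT.const_mul _)
      exact ((hL.const_mul _).mul hT').smul (differentiableAt_comp_hyperbolaMap hδ hδ' hlam hU
        (by linarith [hw.2]) (by linarith [hw.1]))
    · have hT := hyperbolaMap_notMem_sector hδ hδ' (α := α) (w := w)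
        (by linarith [hw.2]) (by linarith [hw.1])
      have hUw := hbound _ (real_mul_notMem_sector hδ hδ' hT hlam)
      have hs0 : 0 ≤ Real.sin (α - w.im) :=
        Real.sin_nonneg_of_nonneg_of_le_pi (by linarith [hw.2]) (by linarith [hw.1])
      have hs1 : Real.sin (α - w.im) ≤ Real.sin α :=
        Real.sin_le_sin_of_le_of_le_pi_div_two (by linarith [hw.2]) (by linarith) (by linarith [hw.1])
      have hcosh := Real.one_le_cosh w.re
      have hD := norm_deriv_hyperbolaMap_le (α := α) (w := w) (β := α)
        (by linarith [hw.2]) (by linarith [hw.1]) (by linarith)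
      have hTn : (1 - Real.sin α) * ((1 + w.re ^ 2) / 4) ≤ ‖hyperbolaMap α w‖ := by
        rw [norm_hyperbolaMap]
        calc (1 - Real.sin α) * ((1 + w.re ^ 2) / 4) ≤ (1 - Real.sin α) * Real.cosh w.re :=
              mul_le_mul_of_nonneg_left (one_add_sq_div_four_le_cosh _) (by linarith)
          _ ≤ _ := by nlinarith
      have hTpos : 0 < ‖hyperbolaMap α w‖ := lt_of_lt_of_le
        (mul_pos (by linarith) (by positivity)) hTn
      have hnorm : ‖(lam : ℂ) * hyperbolaMap α w‖ = lam * ‖hyperbolaMap α w‖ := by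
        rw [norm_mul, Complex.norm_real, Real.norm_of_nonneg hlam.le]
      have hre : ((lam : ℂ) * hyperbolaMap α w).re ≤ lam := by
        rw [Complex.re_ofReal_mul, hyperbolaMap_re]
        nlinarith [mul_nonneg hs0 (by linarith : 0 ≤ Real.cosh w.re)]
      have hgw := hNb _ hre
      rw [hnorm] at hgw hUw
      rw [mul_comm, ← le_div_iff₀ (by positivity)] at hgw
      have hc : ‖-((lam : ℂ) / (2 * (Real.pi : ℂ) * Complex.I))‖ = lam / (2 * Real.pi) := by
        simp [abs_of_pos hlam, abs_of_pos Real.pi_pos]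
      rw [hΦ]
      simp only [norm_smul, norm_mul, hc]
      calc _ ≤ lam / (2 * Real.pi) * (N / (lam * ‖hyperbolaMap α w‖)) *
            (R * ‖hyperbolaMap α w‖) * (M / (lam * ‖hyperbolaMap α w‖)) := by
            gcongr
        _ = lam / (2 * Real.pi) * R * M * N / (lam ^ 2 * ‖hyperbolaMap α w‖) := by
            field_simp
        _ ≤ lam / (2 * Real.pi) * R * M * N /
              (lam ^ 2 * ((1 - Real.sin α) * ((1 + w.re ^ 2) / 4))) := by
            have : 0 < 1 - Real.sin α := by linarith
            gcongr
        _ = _ := by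
            have : 1 - Real.sin α ≠ 0 := by linarith
            field_simp
  -- On `Im w = α` one has `λ T = λ - i λ sinh x`, and `λ cosh x` is the Jacobian of `s = λ sinh x`.
  have hvert : ∀ x : ℝ, (2 * Real.pi) • Φ (x + α * Complex.I) = |lam * Real.cosh x| •
      (bilateralLaplace g (lam - (lam * Real.sinh x : ℝ) * Complex.I) •
        U (lam - (lam * Real.sinh x : ℝ) * Complex.I)) := by
    intro x
    have hw : (α : ℂ) + Complex.I * (x + α * Complex.I) = x * Complex.I := by
      linear_combination (α : ℂ) * Complex.I_sq
    have hT : lam * hyperbolaMap α (x + α * Complex.I) =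
        lam - (lam * Real.sinh x : ℝ) * Complex.I := by
      rw [hyperbolaMap, hw, Complex.sin_mul_I]
      push_cast
      ring
    have hcp : 0 < lam * Real.cosh x := mul_pos hlam (Real.cosh_pos x)
    simp only [hΦ, hT, deriv_hyperbolaMap, hw, Complex.cos_mul_I]
    rw [← Complex.coe_smul, ← Complex.coe_smul, smul_smul, smul_smul, abs_of_pos hcp]
    congr 1
    have : (Real.pi : ℂ) ≠ 0 := by exact_mod_cast Real.pi_ne_zero
    push_cast
    field_simp
  rw [hswap]
  simp only [hinner]
  rw [hshift, ← integral_smul]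
  simp only [hvert]
  have hsub := integral_image_eq_integral_abs_deriv_smul (s := univ) MeasurableSet.univ
    (f := fun x : ℝ => lam * Real.sinh x) (f' := fun x => lam * Real.cosh x)
    (fun x _ => ((Real.hasDerivAt_sinh x).const_mul lam).hasDerivWithinAt)
    (fun x _ y _ hxy => Real.sinh_injective (mul_left_cancel₀ hlam.ne' hxy))
    (fun s : ℝ => bilateralLaplace g (lam - s * Complex.I) • U (lam - s * Complex.I))
  have himg : (fun x : ℝ => lam * Real.sinh x) '' univ = univ := by
    rw [image_univ, range_eq_univ]
    exact (mul_left_surjective₀ hlam.ne').comp Real.sinh_surjective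
  rw [himg, setIntegral_univ, setIntegral_univ] at hsub
  exact hsub.symm

/-- Needed because `U` is given by the Laplace integral only to the right of `ω`, whereas `λ` is
arbitrary. The product is `O(1/|ζ|²)` between the two lines. -/
theorem integral_bilateralLaplace_smul_vertical_eq (hδ : 0 < δ) (hδ' : δ < Real.pi / 2)
    (hlam : 0 < lam) (hM : 0 ≤ M) (hU : DifferentiableOn ℂ U (sector δ)ᶜ)
    (hbound : ∀ z : ℂ, z ∉ sector δ → ‖U z‖ ≤ M / ‖z‖) (hg : ContDiff ℝ 1 g)
    (hs : HasCompactSupport g) (hpos : tsupport g ⊆ Ioi 0) {c : ℝ} (hc : lam ≤ c) :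
    ∫ s : ℝ, bilateralLaplace g (lam - s * Complex.I) • U (lam - s * Complex.I) =
      ∫ s : ℝ, bilateralLaplace g (c - s * Complex.I) • U (c - s * Complex.I) := by
  obtain ⟨N, hN, hNb⟩ := exists_norm_mul_bilateralLaplace_le hg hs hpos c
  have hdg := differentiable_bilateralLaplace hg.continuous hs
  have hre : ∀ w : ℂ, ((lam : ℂ) - w * Complex.I).re = lam + w.im := by intro w; simp
  have him : ∀ w : ℂ, ((lam : ℂ) - w * Complex.I).im = -w.re := by intro w; simp
  have h := integral_horizontal_eq (a := 0) (b := c - lam) (C := N * M * ((1 + lam ^ 2) / lam ^ 2))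
    (F := fun w : ℂ => bilateralLaplace g (lam - w * Complex.I) • U (lam - w * Complex.I))
    (by linarith) (fun w hw => ?_) (fun w hw => ?_)
  · have e : ∀ x : ℝ, (lam : ℂ) - (x + (c - lam : ℝ) * Complex.I) * Complex.I =
        c - x * Complex.I := by
      intro x
      push_cast
      linear_combination ((lam : ℂ) - c) * Complex.I_sq
    simp only [e] at h
    simpa using h
  · have hz : (lam : ℂ) - w * Complex.I ∉ sector δ :=
      notMem_sector_of_re_pos hδ hδ' (by rw [hre]; linarith [hw.1])
    have hUd : DifferentiableAt ℂ U (lam - w * Complex.I) :=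
      (hU _ hz).differentiableAt ((isOpen_compl_sector hδ hδ').mem_nhds hz)
    have hlin : DifferentiableAt ℂ (fun w : ℂ => (lam : ℂ) - w * Complex.I) w := by fun_prop
    exact ((hdg _).comp w hlin).smul (hUd.comp w hlin)
  · have hz : (lam : ℂ) - w * Complex.I ∉ sector δ :=
      notMem_sector_of_re_pos hδ hδ' (by rw [hre]; linarith [hw.1])
    set ζ := (lam : ℂ) - w * Complex.I with hζ
    have hζn : lam ^ 2 / (1 + lam ^ 2) * (1 + w.re ^ 2) ≤ ‖ζ‖ ^ 2 := by
      rw [Complex.sq_norm, Complex.normSq_apply, hre, him, div_mul_eq_mul_div,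
        div_le_iff₀ (by positivity)]
      have : lam ^ 2 ≤ (lam + w.im) ^ 2 := by
        have := hw.1
        gcongr
        linarith
      nlinarith [mul_le_mul_of_nonneg_right this (by positivity : 0 ≤ 1 + lam ^ 2),
        sq_nonneg (lam ^ 2), sq_nonneg w.re]
    have hζpos : 0 < ‖ζ‖ := by
      have : 0 < ‖ζ‖ ^ 2 := lt_of_lt_of_le (by positivity) hζn
      exact norm_pos_iff.2 fun h => by simp [h] at this
    have hgw := hNb ζ (by rw [hre]; linarith [hw.2])
    rw [mul_comm, ← le_div_iff₀ hζpos] at hgw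
    rw [norm_smul]
    calc _ ≤ N / ‖ζ‖ * (M / ‖ζ‖) := by gcongr; exact hbound ζ hz
      _ = N * M / ‖ζ‖ ^ 2 := by field_simp
      _ ≤ N * M / (lam ^ 2 / (1 + lam ^ 2) * (1 + w.re ^ 2)) := by gcongr
      _ = _ := by field_simp

/-- Both sides have the same pairing with every test function on `(0, ∞)`. Since `u` involves
neither `α` nor `λ`, different contours define the same function. -/
theorem hyperbolicInverse_ae_eq {u : ℝ → X} (hδ : 0 < δ) (hδ' : δ < Real.pi / 2)
    (hlam : 0 < lam) (hM : 0 ≤ M) (hU : IsLaplaceTransformOffSector u U δ)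
    (hbound : ∀ z : ℂ, z ∉ sector δ → ‖U z‖ ≤ M / ‖z‖)
    (h0 : 0 < α) (h1 : α < Real.pi / 2 - δ) :
    ∀ᵐ t ∂(volume.restrict (Ioi (0 : ℝ))), hyperbolicInverse U α lam t = u t := by
  obtain ⟨hUd, ω, hω, hLap⟩ := hU
  have hv := continuousOn_hyperbolicInverse hδ hδ' hlam hM hUd hbound h0 h1
  have hvl : LocallyIntegrableOn (hyperbolicInverse U α lam) (Ioi 0) :=
    hv.locallyIntegrableOn measurableSet_Ioi
  have hul : LocallyIntegrableOn u (Ioi 0) := by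
    have := hω.locallyIntegrableOn.continuousOn_smul isOpen_Ioi.isLocallyClosed
      (g := fun t => Real.exp (ω * t)) (by fun_prop)
    refine this.congr (.of_forall fun t => ?_)
    simp [smul_smul, ← Real.exp_add]
  rw [ae_restrict_iff' measurableSet_Ioi]
  have key := isOpen_Ioi.ae_eq_zero_of_integral_contDiff_smul_eq_zero (μ := volume)
    (hvl.sub hul) (fun g hg hs hpos => ?_)
  · filter_upwards [key] with t ht htp
    exact sub_eq_zero.1 (ht htp)
  set G : ℝ → ℂ := fun t => g t with hG
  have hGs : HasCompactSupport G := hs.comp_left Complex.ofReal_zero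
  have hGc : ContDiff ℝ ((⊤ : ℕ∞) : WithTop ℕ∞) G := Complex.ofRealCLM.contDiff.comp hg
  have hGpos : tsupport G ⊆ Ioi 0 := (tsupport_comp_subset Complex.ofReal_zero g).trans hpos
  -- An abscissa that is reachable from `λ` by a shift to the right and lies beyond `ω`.
  set c := max lam (ω + 1) with hc
  have hc0 : 0 < c := hlam.trans_le (le_max_left _ _)
  have hωc : ω < c := (lt_add_one ω).trans_le (le_max_right _ _)
  have hcu : IntegrableOn (fun t : ℝ => Real.exp (-(c * t)) • u t) (Ioi 0) := by
    refine hω.norm.mono' ?_ ?_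
    · have : AEStronglyMeasurable u (volume.restrict (Ioi 0)) := hul.aestronglyMeasurable
      exact (by fun_prop : Continuous fun t : ℝ => Real.exp (-(c * t))).aestronglyMeasurable.smul this
    · rw [ae_restrict_iff' measurableSet_Ioi]
      refine .of_forall fun t (ht : 0 < t) => ?_
      rw [norm_smul, norm_smul, Real.norm_of_nonneg (Real.exp_pos _).le,
        Real.norm_of_nonneg (Real.exp_pos _).le]
      gcongr
  have e1 := integral_smul_hyperbolicInverse hδ hδ' hlam hM hUd hbound h0 h1
    (hGc.of_le (by exact_mod_cast le_top)) hGs hGpos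
  have e2 := integral_bilateralLaplace_smul_vertical_eq hδ hδ' hlam hM hUd hbound
    (hGc.of_le (by exact_mod_cast le_top)) hGs hGpos (le_max_left lam (ω + 1))
  have e3 := integral_bilateralLaplace_smul_eq hGc hGs hGpos hcu
  have e4 : ∀ s : ℝ, U (c - s * Complex.I) =
      ∫ t in Ioi (0 : ℝ), Complex.exp (-((c - s * Complex.I) * (t : ℂ))) • u t := fun s =>
    hLap _ (notMem_sector_of_re_pos hδ hδ' (by simpa using hc0)) (by simpa using hωc)
  simp only [← e4] at e3
  have e5 := smul_right_injective X Real.two_pi_pos.ne' (e1.trans (e2.trans e3))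
  simp only [hG, Complex.coe_smul] at e5
  have i1 : Integrable fun t => g t • hyperbolicInverse U α lam t :=
    integrable_smul_of_tsupport_subset hvl hg.continuous hs hpos
  have i2 : Integrable fun t => g t • u t :=
    integrable_smul_of_tsupport_subset hul hg.continuous hs hpos
  simp only [Pi.sub_apply, smul_sub]
  rw [integral_sub i1 i2, e5, sub_self]

end Inversion

/-! ### Integrals of `exp (-γ (cosh s - c))` and the factor `L` -/

section ExponentialIntegrals

variable {γ c : ℝ}

open Filter Topology in
-- Put `x(s) = γ (e^s/2 - c)`. Since `cosh s ≥ e^s/2` and `1 - e^{-x} ≤ x ≤ x'`, the integrand is at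
-- most `e^{-x} ≤ x' e^{-x} / (1 - e^{-x})`, the derivative of `log (1 - e^{-x})`. The lower limit
-- is the point where `x = γ`.
theorem integral_Ioi_exp_neg_mul_cosh_sub_le (hγ : 0 < γ) (hc : 0 ≤ c) :
    IntegrableOn (fun s => Real.exp (-(γ * (Real.cosh s - c)))) (Ioi (Real.log (2 * (1 + c)))) ∧
    ∫ s in Ioi (Real.log (2 * (1 + c))), Real.exp (-(γ * (Real.cosh s - c))) ≤
      |Real.log (1 - Real.exp (-γ))| := by
  set s₀ := Real.log (2 * (1 + c)) with hs₀
  set x : ℝ → ℝ := fun s => γ * (Real.exp s / 2 - c) with hx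
  have hxd : ∀ s, HasDerivAt x (γ * (Real.exp s / 2)) s := fun s =>
    (((Real.hasDerivAt_exp s).div_const 2).sub_const c).const_mul γ
  have hx₀ : x s₀ = γ := by
    simp only [hx, hs₀]
    rw [Real.exp_log (by positivity)]
    ring
  have hxpos : ∀ s ∈ Ici s₀, 0 < x s := by
    intro s (hs : s₀ ≤ s)
    have : x s₀ ≤ x s := by
      simp only [hx]
      gcongr
    linarith
  have hlt : ∀ s ∈ Ici s₀, 0 < 1 - Real.exp (-x s) := by
    intro s hs
    have : Real.exp (-x s) < 1 := by
      rw [Real.exp_lt_one_iff]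
      linarith [hxpos s hs]
    linarith
  set F : ℝ → ℝ := fun s => Real.log (1 - Real.exp (-x s)) with hF
  set F' : ℝ → ℝ := fun s => γ * (Real.exp s / 2) * Real.exp (-x s) / (1 - Real.exp (-x s)) with hF'
  have hderiv : ∀ s ∈ Ici s₀, HasDerivAt F (F' s) s := by
    intro s hs
    have h := (((hxd s).neg.exp).const_sub 1).log (hlt s hs).ne'
    refine h.congr_deriv ?_
    simp only [hF', Pi.neg_apply]
    ring
  have hnonneg : ∀ s ∈ Ioi s₀, 0 ≤ F' s := fun s hs =>
    div_nonneg (by positivity) (hlt s (Ioi_subset_Ici_self hs)).le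
  have hlim : Tendsto F atTop (𝓝 0) := by
    have h1 : Tendsto x atTop atTop := by
      refine Tendsto.const_mul_atTop hγ ?_
      exact tendsto_atTop_add_const_right _ (-c) (Real.tendsto_exp_atTop.atTop_div_const two_pos)
    have h2 : Tendsto (fun s => 1 - Real.exp (-x s)) atTop (𝓝 (1 - 0)) :=
      tendsto_const_nhds.sub (Real.tendsto_exp_neg_atTop_nhds_zero.comp h1)
    rw [sub_zero] at h2
    simpa using h2.log one_ne_zero
  have hint := integrableOn_Ioi_deriv_of_nonneg' hderiv hnonneg hlim
  have hval := integral_Ioi_of_hasDerivAt_of_nonneg' hderiv hnonneg hlim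
  have hle : ∀ s ∈ Ioi s₀, Real.exp (-(γ * (Real.cosh s - c))) ≤ F' s := by
    intro s hs
    have h1 := hlt s (Ioi_subset_Ici_self hs)
    have h2 : x s ≤ γ * (Real.cosh s - c) := by
      simp only [hx, Real.cosh_eq]
      have := Real.exp_pos (-s)
      gcongr
      linarith
    have h3 : 1 - Real.exp (-x s) ≤ γ * (Real.exp s / 2) := by
      have h4 := Real.add_one_le_exp (-x s)
      have h5 : x s = γ * (Real.exp s / 2) - γ * c := by simp only [hx]; ring
      have h6 : 0 ≤ γ * c := by positivity
      linarith
    rw [le_div_iff₀ h1]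
    calc Real.exp (-(γ * (Real.cosh s - c))) * (1 - Real.exp (-x s))
        ≤ Real.exp (-x s) * (γ * (Real.exp s / 2)) := by gcongr
      _ = _ := by ring
  have hint' : IntegrableOn (fun s => Real.exp (-(γ * (Real.cosh s - c)))) (Ioi s₀) := by
    refine hint.mono' (by fun_prop) ?_
    rw [ae_restrict_iff' measurableSet_Ioi]
    refine .of_forall fun s hs => ?_
    rw [Real.norm_of_nonneg (Real.exp_pos _).le]
    exact hle s hs
  refine ⟨hint', (setIntegral_mono_on hint' hint measurableSet_Ioi hle).trans ?_⟩
  rw [hval, hF]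
  simp only [hx₀, zero_sub]
  exact neg_le_abs _

/-- On the initial interval the integrand is at most `1`, so the interval contributes no more than
its length. -/
theorem integral_Ioi_zero_exp_neg_mul_cosh_sub_le (hγ : 0 < γ) (hc : 0 ≤ c) (hc' : c ≤ 1) :
    IntegrableOn (fun s => Real.exp (-(γ * (Real.cosh s - c)))) (Ioi 0) ∧
    ∫ s in Ioi (0 : ℝ), Real.exp (-(γ * (Real.cosh s - c))) ≤
      Real.log (2 * (1 + c)) + |Real.log (1 - Real.exp (-γ))| := by
  obtain ⟨h1, h2⟩ := integral_Ioi_exp_neg_mul_cosh_sub_le hγ hc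
  have hs₀ : 0 ≤ Real.log (2 * (1 + c)) := Real.log_nonneg (by linarith)
  have hcont : Continuous fun s => Real.exp (-(γ * (Real.cosh s - c))) := by fun_prop
  have h3 : IntegrableOn (fun s => Real.exp (-(γ * (Real.cosh s - c))))
      (Ioc 0 (Real.log (2 * (1 + c)))) :=
    (hcont.integrableOn_Icc).mono_set Ioc_subset_Icc_self
  have hu := Ioc_union_Ioi_eq_Ioi hs₀
  refine ⟨hu ▸ h3.union h1, ?_⟩
  rw [← hu, setIntegral_union (Ioc_disjoint_Ioi le_rfl) measurableSet_Ioi h3 h1]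
  refine add_le_add ?_ h2
  have := norm_setIntegral_le_of_norm_le_const (μ := volume) (C := 1)
    (s := Ioc 0 (Real.log (2 * (1 + c)))) (f := fun s => Real.exp (-(γ * (Real.cosh s - c))))
    (by simp) (fun s _ => by
      rw [Real.norm_of_nonneg (Real.exp_pos _).le, Real.exp_le_one_iff]
      have := mul_nonneg hγ.le (by linarith [Real.one_le_cosh s] : 0 ≤ Real.cosh s - c)
      linarith)
  refine (Real.le_norm_self _).trans (this.trans_eq ?_)
  simp [hs₀]

theorem integrable_exp_neg_mul_cosh (hγ : 0 < γ) :
    Integrable fun x => Real.exp (-(γ * Real.cosh x)) := by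
  refine (integrable_const_div_one_add_sq (4 / γ)).mono' (by fun_prop) (.of_forall fun x => ?_)
  rw [Real.norm_of_nonneg (Real.exp_pos _).le]
  exact exp_neg_mul_cosh_le hγ x

theorem integral_exp_neg_mul_cosh_le (hγ : 0 < γ) :
    ∫ x, Real.exp (-(γ * Real.cosh x)) ≤ 2 * logFactor γ := by
  have h := (integral_Ioi_zero_exp_neg_mul_cosh_sub_le hγ le_rfl zero_le_one).2
  have h2 := integral_comp_abs (f := fun x => Real.exp (-(γ * Real.cosh x)))
  simp only [Real.cosh_abs, sub_zero, add_zero, mul_one] at h h2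
  rw [h2, logFactor]
  have := Real.log_two_lt_d9
  linarith

theorem integral_Ioi_exp_neg_mul_cosh_sub_one_le (hγ : 0 < γ) :
    IntegrableOn (fun s => Real.exp (-(γ * (Real.cosh s - 1)))) (Ioi 0) ∧
    ∫ s in Ioi (0 : ℝ), Real.exp (-(γ * (Real.cosh s - 1))) ≤ 2 * logFactor γ := by
  obtain ⟨h1, h2⟩ := integral_Ioi_zero_exp_neg_mul_cosh_sub_le hγ zero_le_one le_rfl
  refine ⟨h1, h2.trans ?_⟩
  have h4 : Real.log (2 * (1 + 1)) = 2 * Real.log 2 := by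
    rw [show (2 * (1 + 1) : ℝ) = 2 ^ 2 by norm_num, Real.log_pow]
    norm_num
  rw [h4, logFactor]
  have := Real.log_two_lt_d9
  have := abs_nonneg (Real.log (1 - Real.exp (-γ)))
  linarith

theorem mul_sum_le_integral_Ioi {f : ℝ → ℝ} {h : ℝ} (hh : 0 < h) (hf : AntitoneOn f (Ici 0))
    (h0 : ∀ x, 0 ≤ f x) (hi : IntegrableOn f (Ioi 0)) (m : ℕ) :
    h * ∑ i ∈ Finset.range m, f (h * (i + 1 : ℕ)) ≤ ∫ x in Ioi (0 : ℝ), f x := by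
  have h1 : AntitoneOn (fun x => f (h * x)) (Icc 0 (0 + (m : ℝ))) := fun x hx y hy hxy =>
    hf (mul_nonneg hh.le hx.1) (mul_nonneg hh.le hy.1) (mul_le_mul_of_nonneg_left hxy hh.le)
  have h2 := h1.sum_le_integral
  simp only [zero_add] at h2
  refine (mul_le_mul_of_nonneg_left h2 hh.le).trans ?_
  rw [intervalIntegral.mul_integral_comp_mul_left, mul_zero,
    intervalIntegral.integral_of_le (by positivity)]
  exact setIntegral_mono_set hi (.of_forall h0) Ioc_subset_Ioi_self.eventuallyLE

/-- The difference is `(cosh a - 1)(cosh s - 1) + sinh a sinh s`. This separates the size at the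
truncation point from the decay beyond it. -/
theorem cosh_sub_one_le_cosh_add_sub {a s : ℝ} (ha : 0 ≤ a) (hs : 0 ≤ s) :
    Real.cosh s - 1 ≤ Real.cosh (a + s) - Real.cosh a := by
  rw [Real.cosh_add]
  have h1 := Real.one_le_cosh a
  have h2 := Real.one_le_cosh s
  have h3 := mul_nonneg (Real.sinh_nonneg_iff.2 ha) (Real.sinh_nonneg_iff.2 hs)
  nlinarith [mul_nonneg (sub_nonneg.2 h1) (sub_nonneg.2 h2)]

end ExponentialIntegrals

/-! ### Truncated sums and values at points of continuity -/

open Filter Topology in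
/-- Truncation error of a symmetric partial sum. -/
theorem norm_tsum_sub_sum_Icc_le {E : Type*} [NormedAddCommGroup E] {f : ℤ → E}
    (hf : Summable f) (n : ℕ) {b : ℕ → ℝ} {B : ℝ}
    (hpos : ∀ i : ℕ, ‖f ((n + (i + 1) : ℕ) : ℤ)‖ ≤ b i)
    (hneg : ∀ i : ℕ, ‖f (-((n + (i + 1) : ℕ) : ℤ))‖ ≤ b i)
    (hb : ∀ m, ∑ i ∈ Finset.range m, b i ≤ B) :
    ‖(∑' k, f k) - ∑ k ∈ Finset.Icc (-(n : ℤ)) n, f k‖ ≤ 2 * B := by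
  have hstep : ∀ m : ℕ, ‖(∑ k ∈ Finset.Icc (-((n + m : ℕ) : ℤ)) ((n + m : ℕ) : ℤ), f k) -
      ∑ k ∈ Finset.Icc (-(n : ℤ)) n, f k‖ ≤ 2 * ∑ i ∈ Finset.range m, b i := by
    intro m
    induction m with
    | zero => simp
    | succ m ih =>
      have hset : Finset.Icc (-((n + (m + 1) : ℕ) : ℤ)) ((n + (m + 1) : ℕ) : ℤ) =
          insert (((n + (m + 1) : ℕ) : ℤ)) (insert (-((n + (m + 1) : ℕ) : ℤ))
            (Finset.Icc (-((n + m : ℕ) : ℤ)) ((n + m : ℕ) : ℤ))) := by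
        ext k
        simp only [Finset.mem_Icc, Finset.mem_insert]
        omega
      rw [hset, Finset.sum_insert, Finset.sum_insert, Finset.sum_range_succ, add_sub_assoc,
        add_sub_assoc]
      · refine (norm_add_le _ _).trans ?_
        have := norm_add_le (f (-((n + (m + 1) : ℕ) : ℤ)))
          ((∑ k ∈ Finset.Icc (-((n + m : ℕ) : ℤ)) ((n + m : ℕ) : ℤ), f k) -
            ∑ k ∈ Finset.Icc (-(n : ℤ)) n, f k)
        linarith [hpos m, hneg m]
      · simp only [Finset.mem_Icc]
        omega
      · simp only [Finset.mem_Icc, Finset.mem_insert]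
        omega
  have hlim : Tendsto (fun m : ℕ => ∑ k ∈ Finset.Icc (-((n + m : ℕ) : ℤ)) ((n + m : ℕ) : ℤ), f k)
      atTop (𝓝 (∑' k, f k)) :=
    (hf.hasSum.comp (Finset.tendsto_Icc_neg (R := ℤ))).comp
      (tendsto_atTop_mono (fun m => Nat.le_add_left m n) tendsto_id)
  refine le_of_tendsto (hlim.sub_const _).norm (.of_forall fun m => (hstep m).trans ?_)
  linarith [hb m]

/-- A nonzero difference at `t` would persist on a neighbourhood, which has positive measure;
continuity at the single point `t` is enough. -/
theorem eq_of_ae_eq_restrict_of_continuousAt {E : Type*} [NormedAddCommGroup E] {u v : ℝ → E}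
    {s : Set ℝ} (hs : IsOpen s) (h : ∀ᵐ t ∂(volume.restrict s), v t = u t) {t : ℝ} (ht : t ∈ s)
    (hu : ContinuousAt u t) (hv : ContinuousAt v t) : v t = u t := by
  by_contra hne
  have hev := (hv.sub hu).eventually_ne (sub_ne_zero.2 hne)
  have hmem : s ∩ {r | v r ≠ u r} ∈ nhds t := by
    filter_upwards [hs.mem_nhds ht, hev] with r hr hr'
    exact ⟨hr, sub_ne_zero.1 hr'⟩
  have hpos := Measure.measure_pos_of_mem_nhds volume hmem
  rw [ae_restrict_iff' hs.measurableSet, ae_iff] at h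
  refine hpos.ne' (measure_mono_null (fun r hr => ?_) h)
  simpa using hr

/-! ### Discretization and truncation errors -/

section ErrorBound

variable {X : Type*} [NormedAddCommGroup X] [NormedSpace ℂ X] [CompleteSpace X] {U : ℂ → X}
  {α d δ M lam h t t₀ : ℝ}

/-- The smallest sine, at `Im w = d`, and the smallest time `t₀` give the rate `γ` on both boundary
lines. Two lines with `2 L(γ)` each turn `1/(2π)` into the `2/π` of `φ`. -/
theorem norm_hyperbolicInverse_sub_tsum_le (hδ : 0 < δ) (hδ' : δ < Real.pi / 2)
    (hlam : 0 < lam) (hM : 0 ≤ M) (hU : DifferentiableOn ℂ U (sector δ)ᶜ)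
    (hbound : ∀ z : ℂ, z ∉ sector δ → ‖U z‖ ≤ M / ‖z‖) (hd : 0 < d) (h0 : 0 < α - d)
    (h1 : α + d < Real.pi / 2 - δ) (hh : 0 < h) (ht₀ : 0 < t₀) (ht : t₀ ≤ t) :
    ‖hyperbolicInverse U α lam t -
        (h : ℂ) • ∑' k : ℤ, inversionIntegrand U α lam t (k * h)‖ ≤
      M * phiConst α d * logFactor (lam * t₀ * Real.sin (α - d)) * Real.exp (lam * t) *
        (Real.exp (-(2 * Real.pi * d / h)) / (1 - Real.exp (-(2 * Real.pi * d / h)))) := by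
  have hpi := Real.pi_pos
  have hmem : ∀ w : ℂ, |w.im| ≤ d → α - w.im ∈ Icc (α - d) (α + d) := fun w hw => by
    rw [abs_le] at hw
    constructor <;> linarith
  have hs : 0 < Real.sin (α - d) := Real.sin_pos_of_pos_of_lt_pi h0 (by linarith)
  set γ := lam * t₀ * Real.sin (α - d) with hγ
  have hγ0 : 0 < γ := by positivity
  set C := M / (2 * Real.pi) * √((1 + Real.sin (α + d)) / (1 - Real.sin (α + d))) with hC
  have hC0 : 0 ≤ C := by positivity
  have hmain := norm_integral_sub_tsum_le_of_strip (F := inversionIntegrand U α lam t) hd hh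
    (fun w hw => differentiableAt_inversionIntegrand hδ hδ' hlam hU (h0.le.trans (hmem w hw).1)
      ((hmem w hw).2.trans_lt h1))
    (fun w hw => norm_inversionIntegrand_le_div hδ hδ' hlam hM hbound h0 h1 (ht₀.trans_le ht)
      ⟨le_rfl, le_rfl⟩ (hmem w hw))
  have hline : ∀ y : ℝ, |y| ≤ d → ∫ x : ℝ, ‖inversionIntegrand U α lam t (x + y * Complex.I)‖ ≤
      C * Real.exp (lam * t) * (2 * logFactor γ) := by
    intro y hy
    refine le_trans ?_ (mul_le_mul_of_nonneg_left (integral_exp_neg_mul_cosh_le hγ0)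
      (by positivity))
    rw [← integral_const_mul]
    refine integral_mono_of_nonneg (.of_forall fun x => norm_nonneg _)
      ((integrable_exp_neg_mul_cosh hγ0).const_mul _) (.of_forall fun x => ?_)
    have him : ((x : ℂ) + y * Complex.I).im = y := by simp
    have hm := hmem (x + y * Complex.I) (by rwa [him])
    refine (norm_inversionIntegrand_le hδ hδ' hlam hbound (h0.le.trans hm.1) hm.2 h1).trans ?_
    change C * _ ≤ C * _ * _
    rw [mul_assoc C, ← Real.exp_add, him]
    rw [him] at hm
    refine mul_le_mul_of_nonneg_left (Real.exp_le_exp.2 ?_) hC0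
    have h2 : Real.sin (α - d) ≤ Real.sin (α - y) :=
      Real.sin_le_sin_of_le_of_le_pi_div_two (by linarith) (by linarith [hm.2]) hm.1
    have h3 := Real.cosh_pos x
    have h4 : γ * Real.cosh x ≤ lam * t * Real.sin (α - y) * Real.cosh x := by
      rw [hγ]
      have : 0 ≤ lam * t := mul_nonneg hlam.le (ht₀.le.trans ht)
      gcongr
    simp only [Complex.add_re, Complex.ofReal_re, Complex.mul_re, Complex.I_re, mul_zero,
      Complex.ofReal_im, Complex.I_im, zero_mul, sub_self, add_zero]
    linarith
  refine hmain.trans ?_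
  set ε := Real.exp (-(2 * Real.pi * d / h)) with hε
  have hε1 : ε < 1 := by
    rw [hε, Real.exp_lt_one_iff]
    have : 0 < 2 * Real.pi * d / h := by positivity
    linarith
  have hq : 0 ≤ ε / (1 - ε) := div_nonneg (Real.exp_pos _).le (by linarith)
  have h2 := mul_le_mul_of_nonneg_left (add_le_add (hline d (abs_of_pos hd).le)
    (hline (-d) (by simp [abs_of_pos hd]))) hq
  refine h2.trans_eq ?_
  rw [hC, phiConst]
  ring

/-- Each tail is dominated by its size at `n h` times a Riemann sum at right endpoints of a
decreasing function with integral at most `2 L(γ)`; the two tails again give `φ`. -/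
theorem norm_tsum_sub_trapezoidalApprox_le (hδ : 0 < δ) (hδ' : δ < Real.pi / 2)
    (hlam : 0 < lam) (hM : 0 ≤ M) (hbound : ∀ z : ℂ, z ∉ sector δ → ‖U z‖ ≤ M / ‖z‖)
    (hd : 0 < d) (h0 : 0 < α - d)
    (h1 : α + d < Real.pi / 2 - δ) (hh : 0 < h) (ht₀ : 0 < t₀) (ht : t₀ ≤ t) (n : ℕ) :
    ‖((h : ℂ) • ∑' k : ℤ, inversionIntegrand U α lam t (k * h)) -
        trapezoidalApprox U α lam h n t‖ ≤
      M * phiConst α d * logFactor (lam * t₀ * Real.sin (α - d)) *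
        Real.exp (lam * t * (1 - Real.sin α * Real.cosh (n * h))) := by
  have hpi := Real.pi_pos
  have hs : 0 < Real.sin (α - d) := Real.sin_pos_of_pos_of_lt_pi h0 (by linarith)
  have hsα : Real.sin (α - d) ≤ Real.sin α :=
    Real.sin_le_sin_of_le_of_le_pi_div_two (by linarith) (by linarith) (by linarith)
  set γ := lam * t₀ * Real.sin (α - d) with hγ
  have hγ0 : 0 < γ := by positivity
  set C := M / (2 * Real.pi) * √((1 + Real.sin (α + d)) / (1 - Real.sin (α + d))) with hC
  have hC0 : 0 ≤ C := by positivity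
  set E := Real.exp (lam * t * (1 - Real.sin α * Real.cosh (n * h))) with hE
  have hnorm : ∀ x : ℝ, ‖inversionIntegrand U α lam t x‖ ≤
      C * Real.exp (lam * t * (1 - Real.sin α * Real.cosh x)) := fun x => by
    simpa using norm_inversionIntegrand_le (α := α) (w := x) (t := t) hδ hδ' hlam hbound
      (by simp; linarith) (by simp; linarith) h1
  have hsum : Summable fun k : ℤ => inversionIntegrand U α lam t (k * h) := by
    refine summable_of_norm_le_div_one_add_sq
      (C := C * (Real.exp (lam * t) * (4 / (lam * t * Real.sin (α - d))))) hh fun k => ?_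
    have := norm_inversionIntegrand_le_div (α := α) (w := k * h) hδ hδ' hlam hM hbound h0 h1
      (ht₀.trans_le ht) ⟨le_rfl, le_rfl⟩ (by simp [hd.le])
    rw [← hC] at this
    simpa [mul_comm] using this
  have hpt : ∀ i : ℕ, C * Real.exp (lam * t * (1 - Real.sin α * Real.cosh ((n + (i + 1) : ℕ) * h)))
      ≤ C * E * Real.exp (-(γ * (Real.cosh (h * (i + 1 : ℕ)) - 1))) := by
    intro i
    rw [mul_assoc C, hE, ← Real.exp_add]
    refine mul_le_mul_of_nonneg_left (Real.exp_le_exp.2 ?_) hC0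
    have h2 := cosh_sub_one_le_cosh_add_sub (a := n * h) (s := h * (i + 1 : ℕ))
      (by positivity) (by positivity)
    have h3 : ((n + (i + 1) : ℕ) : ℝ) * h = n * h + h * (i + 1 : ℕ) := by push_cast; ring
    have hlt : 0 ≤ lam * t := mul_nonneg hlam.le (ht₀.le.trans ht)
    have h4 : γ ≤ lam * t * Real.sin α := by
      rw [hγ]
      gcongr
    have h5 := Real.one_le_cosh (h * (i + 1 : ℕ))
    have h6 := mul_le_mul h4 h2 (by linarith) (hγ0.le.trans h4)
    rw [h3]
    linarith
  have hanti : AntitoneOn (fun s => Real.exp (-(γ * (Real.cosh s - 1)))) (Ici 0) := by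
    intro x (hx : 0 ≤ x) y (hy : 0 ≤ y) hxy
    have : Real.cosh x ≤ Real.cosh y := by
      rwa [Real.cosh_le_cosh, abs_of_nonneg hx, abs_of_nonneg hy]
    simp only
    gcongr
  obtain ⟨hi, hI⟩ := integral_Ioi_exp_neg_mul_cosh_sub_one_le hγ0
  have htail := norm_tsum_sub_sum_Icc_le hsum n
    (b := fun i => C * E * Real.exp (-(γ * (Real.cosh (h * (i + 1 : ℕ)) - 1))))
    (B := C * E * (2 * logFactor γ) / h) (fun i => ?_) (fun i => ?_) (fun m => ?_)
  · rw [trapezoidalApprox, ← smul_sub, norm_smul, Complex.norm_real, Real.norm_of_nonneg hh.le]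
    refine (mul_le_mul_of_nonneg_left htail hh.le).trans_eq ?_
    rw [hC, phiConst]
    field_simp
  · refine le_trans ?_ (hpt i)
    have := hnorm (((n + (i + 1) : ℕ) : ℝ) * h)
    simpa using this
  · refine le_trans ?_ (hpt i)
    have := hnorm (-(((n + (i + 1) : ℕ) : ℝ) * h))
    rw [Real.cosh_neg] at this
    simpa only [Int.cast_neg, Int.cast_natCast, neg_mul, Complex.ofReal_neg, Complex.ofReal_mul,
      Complex.ofReal_natCast] using this
  · rw [← Finset.mul_sum, mul_div_assoc]
    refine mul_le_mul_of_nonneg_left ?_ (by positivity)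
    rw [le_div_iff₀ hh, mul_comm]
    exact (mul_sum_le_integral_Ioi hh hanti (fun x => (Real.exp_pos _).le) hi m).trans hI

end ErrorBound

/-- A locally integrable `u` is only determined almost everywhere; the bound is stated for its
continuous representative `v` on `(0, ∞)`, which agrees with `u` wherever `u` is continuous. -/
theorem theorem1 {X : Type*} [NormedAddCommGroup X] [NormedSpace ℂ X] [CompleteSpace X]
    (u : ℝ → X) (U : ℂ → X) (δ M : ℝ)
    (hδ : 0 < δ) (hδ' : δ < Real.pi / 2) (hM : 0 < M)
    (hU : IsLaplaceTransformOffSector u U δ)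
    (hbound : ∀ z : ℂ, z ∉ sector δ → ‖U z‖ ≤ M / ‖z‖) :
    ∃ v : ℝ → X, ContinuousOn v (Ioi 0) ∧
      (∀ᵐ t ∂(volume.restrict (Ioi (0 : ℝ))), v t = u t) ∧
      (∀ t : ℝ, 0 < t → ContinuousAt u t → v t = u t) ∧
      ∀ (α d : ℝ), 0 < d → 0 < α - d → α + d < Real.pi / 2 - δ →
      ∀ (t₀ Λ θ : ℝ) (n : ℕ), 0 < t₀ → 1 ≤ Λ → 0 < θ → θ < 1 → 1 ≤ n →
      ∀ (a h lam ε : ℝ),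
        a = Real.arcosh (Λ / ((1 - θ) * Real.sin α)) →
        h = a / n →
        lam = 2 * Real.pi * d * n * (1 - θ) / (t₀ * Λ * a) →
        ε = Real.exp (-(2 * Real.pi * d / a * n)) →
        ∀ t ∈ Icc t₀ (Λ * t₀),
          ‖v t - trapezoidalApprox U α lam h n t‖ ≤
            M * phiConst α d * logFactor (lam * t₀ * Real.sin (α - d)) *
              (2 * ε ^ θ / (1 - ε)) := by
  have hpi := Real.pi_pos
  -- The representative has to be fixed before `α` and `λ` are known; any admissible angle works,
  -- here the midpoint with `λ = 1`.
  have hα₀ : 0 < (Real.pi / 2 - δ) / 2 := by linarith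
  have hα₀' : (Real.pi / 2 - δ) / 2 < Real.pi / 2 - δ := by linarith
  have hv := continuousOn_hyperbolicInverse hδ hδ' one_pos hM.le hU.1 hbound hα₀ hα₀'
  have hvu := hyperbolicInverse_ae_eq hδ hδ' one_pos hM.le hU hbound hα₀ hα₀'
  refine ⟨hyperbolicInverse U ((Real.pi / 2 - δ) / 2) 1, hv, hvu, fun t ht hu =>
    eq_of_ae_eq_restrict_of_continuousAt isOpen_Ioi hvu ht hu (hv.continuousAt (Ioi_mem_nhds ht)),
    ?_⟩
  intro α d hd h0 h1 t₀ Λ θ n ht₀ hΛ hθ hθ' hn a h lam ε ha hh hlam hε t ht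
  have hα : 0 < α := by linarith
  have hn0 : (0 : ℝ) < n := by exact_mod_cast hn
  have hs : 0 < Real.sin α := Real.sin_pos_of_pos_of_lt_pi hα (by linarith)
  have hs1 : Real.sin α < 1 := by
    rw [← Real.sin_pi_div_two]
    exact Real.sin_lt_sin_of_lt_of_le_pi_div_two (by linarith) le_rfl (by linarith)
  have hθ1 : 0 < 1 - θ := by linarith
  have hΛ0 : 0 < Λ := by linarith
  have hden : (1 - θ) * Real.sin α < 1 := by nlinarith
  have harg : 1 < Λ / ((1 - θ) * Real.sin α) := by
    rw [one_lt_div (by positivity)]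
    linarith
  have ha0 : 0 < a := ha ▸ Real.arcosh_pos harg
  have hcosh : Real.cosh a = Λ / ((1 - θ) * Real.sin α) := by
    rw [ha, Real.cosh_arcosh harg.le]
  have hh0 : 0 < h := hh ▸ div_pos ha0 hn0
  have hlam0 : 0 < lam := by rw [hlam]; positivity
  have hnh : n * h = a := by rw [hh]; field_simp
  set q := 2 * Real.pi * d / a * n with hq
  have hq0 : 0 < q := by positivity
  have hqh : 2 * Real.pi * d / h = q := by rw [hq, hh]; field_simp
  -- This identity is the reason for the choice of `λ`: at the largest time `e^{λt}` equals
  -- `ε^{θ-1}`.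
  have hlq : lam * (Λ * t₀) = q * (1 - θ) := by rw [hq, hlam]; field_simp
  have hεθ : ε ^ θ = Real.exp (-(q * θ)) := by
    rw [hε, ← Real.exp_mul, neg_mul]
  have htpos : t ∈ Ioi (0 : ℝ) := ht₀.trans_le ht.1
  have hvt : hyperbolicInverse U ((Real.pi / 2 - δ) / 2) 1 t = hyperbolicInverse U α lam t := by
    have hv' := continuousOn_hyperbolicInverse hδ hδ' hlam0 hM.le hU.1 hbound hα
      (by linarith : α < Real.pi / 2 - δ)
    have hvu' := hyperbolicInverse_ae_eq hδ hδ' hlam0 hM.le hU hbound hα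
      (by linarith : α < Real.pi / 2 - δ)
    refine Measure.eqOn_open_of_ae_eq (μ := volume) ?_ isOpen_Ioi hv hv' htpos
    filter_upwards [hvu, hvu'] with r h1 h2
    rw [h1, h2]
  have hquad := norm_hyperbolicInverse_sub_tsum_le hδ hδ' hlam0 hM.le hU.1 hbound hd h0 h1 hh0
    ht₀ ht.1
  have htail := norm_tsum_sub_trapezoidalApprox_le hδ hδ' hlam0 hM.le hbound hd h0 h1 hh0
    ht₀ ht.1 n
  rw [hqh, ← hε] at hquad
  rw [hnh, hcosh] at htail
  set K := M * phiConst α d * logFactor (lam * t₀ * Real.sin (α - d)) with hK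
  have hK0 : 0 ≤ K := by
    have : 0 ≤ phiConst α d := by unfold phiConst; positivity
    have : 0 ≤ logFactor (lam * t₀ * Real.sin (α - d)) := by unfold logFactor; positivity
    positivity
  have hε0 : 0 < ε := hε ▸ Real.exp_pos _
  have hε1 : ε < 1 := by
    rw [hε, Real.exp_lt_one_iff]
    linarith
  have hlt : lam * t ≤ q * (1 - θ) := hlq ▸ mul_le_mul_of_nonneg_left ht.2 hlam0.le
  have hexp1 : Real.exp (lam * t) * ε ≤ ε ^ θ := by
    rw [hεθ, hε, ← Real.exp_add, Real.exp_le_exp]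
    linarith
  -- The factor `1 - Λ/(1-θ)` is not positive, so `t = t₀` is the worst case; there the exponent is
  -- `λ t₀ - q ≤ q (1 - θ) - q = -q θ`.
  have hexp2 : Real.exp (lam * t * (1 - Real.sin α * (Λ / ((1 - θ) * Real.sin α)))) ≤ ε ^ θ := by
    rw [hεθ, Real.exp_le_exp]
    have e1 : Real.sin α * (Λ / ((1 - θ) * Real.sin α)) = Λ / (1 - θ) := by field_simp
    have e2 : lam * t₀ * (Λ / (1 - θ)) = q := by
      rw [mul_div_assoc', div_eq_iff hθ1.ne', ← hlq]
      ring
    have e3 : 1 ≤ Λ / (1 - θ) := by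
      rw [one_le_div hθ1]
      linarith
    have e4 : lam * t * (Λ / (1 - θ) - 1) ≥ lam * t₀ * (Λ / (1 - θ) - 1) := by
      have := ht.1
      have : 0 ≤ Λ / (1 - θ) - 1 := by linarith
      gcongr
    have e5 : lam * t₀ ≤ lam * (Λ * t₀) := by
      gcongr
      nlinarith
    rw [e1]
    linarith
  rw [hvt, ← sub_add_sub_cancel _ ((h : ℂ) • ∑' k : ℤ, inversionIntegrand U α lam t (k * h)) _]
  -- The truncation error carries no factor `1 / (1 - ε)`; it is inserted so that both errors take
  -- the same form.
  have hr : ε ^ θ ≤ ε ^ θ / (1 - ε) :=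
    le_div_self (by positivity) (by linarith) (by linarith)
  calc _ ≤ K * Real.exp (lam * t) * (ε / (1 - ε)) +
        K * Real.exp (lam * t * (1 - Real.sin α * (Λ / ((1 - θ) * Real.sin α)))) :=
        (norm_add_le _ _).trans (add_le_add hquad htail)
    _ = K * (Real.exp (lam * t) * ε / (1 - ε)) +
        K * Real.exp (lam * t * (1 - Real.sin α * (Λ / ((1 - θ) * Real.sin α)))) := by ring
    _ ≤ K * (ε ^ θ / (1 - ε)) + K * (ε ^ θ / (1 - ε)) := by
        have : 0 < 1 - ε := by linarith
        gcongr
        exact hexp2.trans hr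
    _ = _ := by ring
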